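/- Let $\mathbb{F}$ be a field, let $k\ge 1$ and $d,n\ge 0$ be integers with $|\mathbb{F}|>d$, and let $L(R)$ be the vector space of linear forms $\sum_i a_ix_i$ in $R=\mathbb{F}[x_1,\dots,x_n]$. Let $C=\sum_{i=1}^k T_i$ be a $\Sigma\Pi\Sigma(k,d)$ circuit, i.e. $T_i=c_i\prod_{j=1}^d \ell_{i,j}$ with $c_i\in\mathbb{F}^*$ and $\ell_{i,j}\in L(R)\setminus\{0\}$; write $L(T_i)$ for the list $(\ell_{i,1},\dots,\ell_{i,d})$. Assume that $C$ is an identity ($\sum_i T_i=0$ in $R$), simple (no nonzero linear form divides all the $T_i$) and strongly minimal ($T_1,\dots,T_{k-1}$ are linearly independent over $\mathbb{F}$); these assumptions force $k\ge 2$. Let $\mathcal I\subseteq\{1,\dots,k\}$ be a maximal set such that the $T_i$, $i\in\mathcal I$, are linearly independent. A linear subspace $K\subseteq L(R)$ is called a nucleus of $C$ (with respect to $\mathcal I$) if (1) $\dim K<2k^2$; (2) for every $i$ there is a bijection $\pi_i$ between the lists $L(T_1)$ and $L(T_i)$ with $\pi_i(\ell)\in\mathbb{F}^*\ell+K$ for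 all $\ell\in L(T_1)$; (3) the polynomials $K_i:=\prod_{j:\,\ell_{i,j}\in K}\ell_{i,j}$, $i\in\mathcal I$, are linearly independent. For $r\ge 1$, a set $S$ of nonzero vectors in $\mathbb{F}^N$, no two of which are scalar multiples of each other, is called $\mathrm{SG}_r$-closed if the linear span of any $r$ linearly independent vectors of $S$ contains at least $r+1$ vectors of $S$; $\mathrm{SG}_r(\mathbb{F},m)$ denotes the largest rank of an $\mathrm{SG}_r$-closed set of at most $m$ vectors in $\mathbb{F}^N$, over all $N$. Then $C$ has a nucleus, and for every nucleus $K$ of $C$ the non-nucleus rank of $C$, i.e. the rank in the quotient space $L(R)/K$ of the set of all forms $\ell_{i,j}$ ($1\le i\le k$, $1\le j\le d$) with $\ell_{i,j}\notin K$, is at most $\mathrm{SG}_{k-1}(\mathbb{F},d)$. -/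

import Mathlib

noncomputable section

namespace DepthThree

/-- The space of linear forms `∑ aᵢ xᵢ` in `F[x₁, …, xₙ]`. -/
abbrev LinForms (F : Type*) [Field F] (n : ℕ) : Submodule F (MvPolynomial (Fin n) F) :=
  MvPolynomial.homogeneousSubmodule (Fin n) F 1

/-- A `ΣΠΣ(k,d)` circuit in `n` variables over `F`: `k` multiplication terms, each a nonzero
constant times a product of a list of `d` nonzero linear forms. -/
structure Circuit (F : Type*) [Field F] (n k d : ℕ) where
  coeff : Fin k → F
  form : Fin k → Fin d → LinForms F n
  coeff_ne_zero : ∀ i, coeff i ≠ 0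
  form_ne_zero : ∀ i j, form i j ≠ 0

/-- `π` is an `I`-matching between the lists `U` and `V`: a bijection between the lists with
`π(ℓ) ∈ F^* ℓ + I` for every entry `ℓ` of `U`. -/
def IsMatching {F M ι κ : Type*} [Field F] [AddCommGroup M] [Module F M]
    (I : Submodule F M) (U : ι → M) (V : κ → M) (π : ι ≃ κ) : Prop :=
  ∀ j, ∃ c : F, c ≠ 0 ∧ ∃ v ∈ I, V (π j) = c • U j + v

/-- The rank of a set `S` of vectors modulo the subspace `K`. -/
def rankMod {F M : Type*} [Field F] [AddCommGroup M] [Module F M]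
    (K : Submodule F M) (S : Set M) : ℕ :=
  Set.finrank F (K.mkQ '' S)

namespace Circuit

variable {F : Type*} [Field F] {n k d : ℕ}

/-- The polynomial computed by the `i`-th multiplication term. -/
def term (C : Circuit F n k d) (i : Fin k) : MvPolynomial (Fin n) F :=
  MvPolynomial.C (C.coeff i) * ∏ j, (C.form i j : MvPolynomial (Fin n) F)

/-- The circuit computes the zero polynomial. -/
def IsIdentity (C : Circuit F n k d) : Prop :=
  ∑ i, C.term i = 0

/-- No nonzero linear form divides all the terms. -/
def IsSimple (C : Circuit F n k d) : Prop :=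
  ¬ ∃ ℓ : LinForms F n, ℓ ≠ 0 ∧ ∀ i, (ℓ : MvPolynomial (Fin n) F) ∣ C.term i

/-- All the terms but the last one are linearly independent. -/
def IsStronglyMinimal (C : Circuit F n k d) : Prop :=
  LinearIndepOn F C.term {i : Fin k | (i : ℕ) + 1 < k}

open Classical in
/-- The product of those forms (with multiplicity) of the `i`-th term that lie in `K`. -/
def nucleusTerm (C : Circuit F n k d) (K : Submodule F (LinForms F n)) (i : Fin k) :
    MvPolynomial (Fin n) F :=
  ∏ j with C.form i j ∈ K, (C.form i j : MvPolynomial (Fin n) F)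

/-- `K` is a nucleus of `C` with respect to the index set `I` (which is to index a maximal
linearly independent set of terms). -/
structure IsNucleus [NeZero k] (C : Circuit F n k d) (I : Set (Fin k))
    (K : Submodule F (LinForms F n)) : Prop where
  rank_lt : Module.finrank F K < 2 * k ^ 2
  matched : ∀ i, ∃ π : Fin d ≃ Fin d, IsMatching K (C.form 0) (C.form i) π
  indep : LinearIndepOn F (C.nucleusTerm K) I

/-- The forms occurring in `C` that lie outside `K`. -/
def nonNucleusPart (C : Circuit F n k d) (K : Submodule F (LinForms F n)) :
    Set (LinForms F n) :=
  {ℓ | (∃ i j, C.form i j = ℓ) ∧ ℓ ∉ K}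

/-- The rank modulo `K` of the forms of `C` that lie outside `K`. -/
def nonNucleusRank (C : Circuit F n k d) (K : Submodule F (LinForms F n)) : ℕ :=
  rankMod K (C.nonNucleusPart K)

end Circuit

/-- `S` is a set of nonzero vectors, no two of which are multiples of each other, such that the
span of any `k` linearly independent vectors of `S` contains at least `k + 1` vectors of `S`. -/
structure IsSGClosed (F : Type*) {M : Type*} [Field F] [AddCommGroup M] [Module F M]
    (k : ℕ) (S : Set M) : Prop where
  ne_zero : ∀ v ∈ S, v ≠ 0
  no_multiples : ∀ v ∈ S, ∀ w ∈ S, v ≠ w → ∀ c : F, w ≠ c • v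
  closed : ∀ V : Finset M, (V : Set M) ⊆ S → V.card = k → LinearIndepOn F id (V : Set M) →
    ((k + 1 : ℕ) : ℕ∞) ≤ (S ∩ (Submodule.span F (V : Set M) : Set M)).encard

/-- The ranks of the `SG_k`-closed sets of at most `m` vectors in `Fⁿ`, over all `n`. -/
def sgRanks (k : ℕ) (F : Type*) [Field F] (m : ℕ) : Set ℕ :=
  {r | ∃ (n : ℕ) (S : Set (Fin n → F)),
    S.encard ≤ m ∧ IsSGClosed F k S ∧ Set.finrank F S = r}

/-- `SG_k(F,m)`: the largest rank of an `SG_k`-closed set of at most `m` vectors in `Fⁿ`,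
over all `n`. -/
def SG (k : ℕ) (F : Type*) [Field F] (m : ℕ) : ℕ :=
  sSup (sgRanks k F m)

/-- The supremum defining `SG k F m` is an attained maximum when `k ≥ 1`. -/
theorem SG_isGreatest {k : ℕ} (hk : 1 ≤ k) (F : Type*) [Field F] (m : ℕ) :
    IsGreatest (sgRanks k F m) (SG k F m) := by
  have hb : BddAbove (sgRanks k F m) := by
    refine ⟨m, ?_⟩
    rintro r ⟨n, S, hS, -, rfl⟩
    have hfin : S.Finite := Set.finite_of_encard_le_coe hS
    have h1 : Set.finrank F S ≤ S.ncard := by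
      have := hfin.fintype
      rw [Set.ncard_eq_toFinset_card']
      exact finrank_span_le_card S
    refine h1.trans ?_
    rw [← hfin.cast_ncard_eq] at hS
    exact_mod_cast hS
  have hne : (sgRanks k F m).Nonempty := by
    refine ⟨_, 0, ∅, by simp, ⟨by simp, by simp, ?_⟩, rfl⟩
    intro V hV hc
    have : V = ∅ := by simpa using hV
    subst this
    simp at hc
    omega
  exact ⟨Nat.sSup_mem hne hb, fun r hr => le_csSup hb hr⟩

end DepthThree

end

/-! Nucleus. Call an ideal `p` supported on a space `K` if it is generated by homogeneous
polynomials in the forms of `K`; forms outside `K` are then nonzerodivisors modulo `p`. For a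
nonzero `D` in the span of the terms, the ideal grows term by term, always avoiding `D`. If `D` lies
in `p + (T_i)`, comparing parts of degree `d` makes `T_i` a scalar multiple of `D` modulo `p`.
Otherwise Chinese remaindering gives a factor `v` of `T_i`, involving only one form beyond `K`, with
`D ∉ p + (v)`, and `v` is added to `p`. After `k` terms, `dim K ≤ k` and every term is a multiple of
`D` modulo `p` (`exists_separating_ideal`). Repeating this along a descending chain of subspaces
gives one `K` of dimension at most `k ^ 2` that serves all `D` (`exists_separating_space`).

Two products of forms that are proportional and nonzero modulo `p` have proportional leading parts
modulo `K`, so unique factorization matches them (`IsSupportedOn.exists_matching`). If the terms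
fell into several matching classes, the sum `D` of one class would be nonzero by strong minimality;
modulo an ideal separating `D`, a term of this class and a term outside it would be proportional and
nonzero, hence matched. A dependence between the `K_i` would give a nonzero `D` with zero leading
part, and an ideal separating this `D` would contain all `K_i`, hence all terms and `D` itself
(`exists_isNucleus`).

Rank. By matching, the directions modulo `K` of the forms outside `K` are those of `T_1`, so there
are at most `d`. Suppose `k - 1` independent directions `V` span no further direction. The parts of
the terms lying over the span of `V` still satisfy a linear relation with nonzero coefficients. With
one variable per direction, they become `K_i * ∏ v, f_{i,v}(X_v)`, up to scalars, with `f_{i,v}`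
monic. This is a relation between `k` elementary tensors with `k - 1` factors, no proper subsum of
whose weights vanishes; it forces some `f_{i,v}` to be independent of `i`
(`exists_constant_factor`). A root of it is a linear form dividing all terms, against simplicity
(`exists_common_form`). So the directions are `SG_{k-1}`-closed. -/

noncomputable section

namespace DepthThree

open MvPolynomial

/-! ### Linear substitutions and ideals supported on a space of linear forms -/

variable {F : Type*} [Field F] {n k d : ℕ}

/-- The variable `xᵢ` as a linear form. -/
def varForm (F : Type*) [Field F] {n : ℕ} (i : Fin n) : LinForms F n :=
  ⟨X i, isHomogeneous_X F i⟩

@[simp]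
theorem coe_varForm (i : Fin n) : (varForm F i : MvPolynomial (Fin n) F) = X i := rfl

instance finite_linForms : Module.Finite F (LinForms F n) :=
  Module.Finite.iff_fg.mpr (homogeneousSubmodule_fg (Fin n) F 1)

/-- The algebra homomorphism on the polynomial ring extending a linear map on linear forms. -/
def liftLin {B : Type*} [CommRing B] [Algebra F B] (φ : LinForms F n →ₗ[F] B) :
    MvPolynomial (Fin n) F →ₐ[F] B :=
  aeval fun i => φ (varForm F i)

theorem liftLin_coe {B : Type*} [CommRing B] [Algebra F B] (φ : LinForms F n →ₗ[F] B)
    (ℓ : LinForms F n) : liftLin φ (ℓ : MvPolynomial (Fin n) F) = φ ℓ := by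
  obtain ⟨f, hf⟩ := ℓ
  have hf' : f ∈ Submodule.span F (Set.range (X : Fin n → MvPolynomial (Fin n) F)) := by
    rwa [← homogeneousSubmodule_one_eq_span_X]
  obtain ⟨c, rfl⟩ := (Submodule.mem_span_range_iff_exists_fun F).mp hf'
  have h : (⟨_, hf⟩ : LinForms F n) = ∑ i, c i • varForm F i := by
    apply Subtype.ext
    simp
  rw [h]
  simp [liftLin]

/-- The subalgebra of polynomials in the linear forms of `K`. -/
def formAlgebra (K : Submodule F (LinForms F n)) : Subalgebra F (MvPolynomial (Fin n) F) :=
  Algebra.adjoin F (Subtype.val '' (K : Set (LinForms F n)))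

theorem coe_mem_formAlgebra {K : Submodule F (LinForms F n)} {ℓ : LinForms F n} (h : ℓ ∈ K) :
    (ℓ : MvPolynomial (Fin n) F) ∈ formAlgebra K :=
  Algebra.subset_adjoin ⟨ℓ, h, rfl⟩

theorem formAlgebra_mono {K K' : Submodule F (LinForms F n)} (h : K ≤ K') :
    formAlgebra K ≤ formAlgebra K' :=
  Algebra.adjoin_mono (Set.image_mono h)

theorem liftLin_eq_of_mem_formAlgebra {B : Type*} [CommRing B] [Algebra F B]
    {K : Submodule F (LinForms F n)} {φ : LinForms F n →ₗ[F] B}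
    {c : MvPolynomial (Fin n) F →ₐ[F] B} (h : ∀ x ∈ K, φ x = c x)
    {a : MvPolynomial (Fin n) F} (ha : a ∈ formAlgebra K) : liftLin φ a = c a := by
  have : formAlgebra K ≤ AlgHom.equalizer (liftLin φ) c := by
    refine Algebra.adjoin_le ?_
    rintro _ ⟨x, hx, rfl⟩
    rw [SetLike.mem_coe, AlgHom.mem_equalizer, liftLin_coe, h x hx]
  exact this ha

/-- `p` is generated by homogeneous polynomials in the linear forms of `K`. -/
def IsSupportedOn (K : Submodule F (LinForms F n)) (p : Ideal (MvPolynomial (Fin n) F)) : Prop :=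
  ∃ G : Set (MvPolynomial (Fin n) F),
    (∀ g ∈ G, g ∈ formAlgebra K ∧ ∃ m, g.IsHomogeneous m) ∧ p = Ideal.span G

theorem isSupportedOn_bot (K : Submodule F (LinForms F n)) : IsSupportedOn K ⊥ :=
  ⟨∅, by simp, by simp⟩

theorem IsSupportedOn.mono {K K' : Submodule F (LinForms F n)} (h : K ≤ K')
    {p : Ideal (MvPolynomial (Fin n) F)} (hp : IsSupportedOn K p) : IsSupportedOn K' p := by
  obtain ⟨G, hG, rfl⟩ := hp
  exact ⟨G, fun g hg => ⟨formAlgebra_mono h (hG g hg).1, (hG g hg).2⟩, rfl⟩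

theorem IsSupportedOn.sup_span_singleton {K : Submodule F (LinForms F n)}
    {p : Ideal (MvPolynomial (Fin n) F)} (hp : IsSupportedOn K p)
    {v : MvPolynomial (Fin n) F} (hv : v ∈ formAlgebra K) {m : ℕ} (hm : v.IsHomogeneous m) :
    IsSupportedOn K (p ⊔ Ideal.span {v}) := by
  obtain ⟨G, hG, rfl⟩ := hp
  refine ⟨G ∪ {v}, ?_, (Ideal.span_union _ _).symm⟩
  rintro g (hg | hg)
  · exact hG g hg
  · rw [Set.mem_singleton_iff] at hg
    subst hg
    exact ⟨hv, m, hm⟩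

theorem IsSupportedOn.homogeneousComponent_mem {K : Submodule F (LinForms F n)}
    {p : Ideal (MvPolynomial (Fin n) F)} (hp : IsSupportedOn K p)
    {f : MvPolynomial (Fin n) F} (hf : f ∈ p) (m : ℕ) : homogeneousComponent m f ∈ p := by
  let := gradedAlgebra (σ := Fin n) (R := F)
  refine homogeneousComponent_mem_of_mem ?_ hf m
  obtain ⟨G, hG, rfl⟩ := hp
  refine Ideal.homogeneous_span _ _ fun g hg => ?_
  obtain ⟨m, hm⟩ := (hG g hg).2
  exact ⟨m, hm⟩

theorem IsSupportedOn.liftLin_mem {B : Type*} [CommRing B] [Algebra F B]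
    {K : Submodule F (LinForms F n)} {φ : LinForms F n →ₗ[F] B}
    {c : MvPolynomial (Fin n) F →ₐ[F] B} (h : ∀ x ∈ K, φ x = c x)
    {p : Ideal (MvPolynomial (Fin n) F)} (hp : IsSupportedOn K p)
    {f : MvPolynomial (Fin n) F} (hf : f ∈ p) : liftLin φ f ∈ p.map c := by
  obtain ⟨G, hG, rfl⟩ := hp
  have : Ideal.span G ≤ (Ideal.map c (Ideal.span G)).comap (liftLin φ) := by
    refine Ideal.span_le.mpr fun g hg => ?_
    rw [SetLike.mem_coe, Ideal.mem_comap, liftLin_eq_of_mem_formAlgebra h (hG g hg).1]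
    exact Ideal.mem_map_of_mem _ (Ideal.subset_span hg)
  exact this hf

/-- A linear form outside `K` is a nonzerodivisor modulo any ideal supported on `K`. -/
theorem IsSupportedOn.mem_of_form_mul_mem {K : Submodule F (LinForms F n)}
    {p : Ideal (MvPolynomial (Fin n) F)} (hp : IsSupportedOn K p) {ℓ : LinForms F n} (hℓ : ℓ ∉ K)
    {f : MvPolynomial (Fin n) F} (hf : (ℓ : MvPolynomial (Fin n) F) * f ∈ p) : f ∈ p := by
  obtain ⟨φ₀, hφ₀, hK⟩ := Submodule.exists_le_ker_of_notMem hℓ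
  obtain ⟨φ, hφ, hK⟩ : ∃ φ : LinForms F n →ₗ[F] F, φ ℓ = 1 ∧ ∀ x ∈ K, φ x = 0 :=
    ⟨(φ₀ ℓ)⁻¹ • φ₀, by simp [hφ₀], fun x hx => by simp [LinearMap.mem_ker.mp (hK hx)]⟩
  -- `Φ` turns `ℓ` into a new variable and fixes `K`, so it carries `p` into its extension, where
  -- the variable can be cancelled coefficientwise. Evaluating the variable at `ℓ` undoes `Φ`.
  let Φ : LinForms F n →ₗ[F] Polynomial (MvPolynomial (Fin n) F) :=
    (Polynomial.CAlgHom (R := F) (A := MvPolynomial (Fin n) F)).toLinearMap ∘ₗ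
      (Submodule.subtype _ ∘ₗ (LinearMap.id - φ.smulRight ℓ)) + φ.smulRight Polynomial.X
  have hΦ : ∀ x, Φ x = Polynomial.C ((x - φ x • ℓ : LinForms F n) : MvPolynomial (Fin n) F) +
      φ x • Polynomial.X := fun x => rfl
  have hc : ∀ x ∈ K, Φ x = Polynomial.CAlgHom (R := F) (x : MvPolynomial (Fin n) F) := by
    intro x hx
    rw [hΦ, hK x hx]
    simp
  have h1 := hp.liftLin_mem hc hf
  have h1 : liftLin Φ (ℓ * f) ∈ p.map (Polynomial.C : MvPolynomial (Fin n) F →+* _) := h1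
  rw [map_mul, liftLin_coe, hΦ, hφ, Ideal.mem_map_C_iff] at h1
  have h2 : liftLin Φ f ∈ p.map (Polynomial.C : MvPolynomial (Fin n) F →+* _) := by
    rw [Ideal.mem_map_C_iff]
    intro m
    have := h1 (m + 1)
    simpa [Polynomial.coeff_X_mul] using this
  have h3 : (Polynomial.aeval (R := MvPolynomial (Fin n) F)
      (ℓ : MvPolynomial (Fin n) F)) (liftLin Φ f) = f := by
    have : ((Polynomial.aeval (R := MvPolynomial (Fin n) F)
        (ℓ : MvPolynomial (Fin n) F)).restrictScalars F).comp (liftLin Φ) = AlgHom.id F _ := by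
      refine MvPolynomial.algHom_ext fun i => ?_
      have : liftLin Φ (X i) = Φ (varForm F i) := liftLin_coe Φ (varForm F i)
      simp [this, hΦ, MvPolynomial.smul_eq_C_mul]
    exact DFunLike.congr_fun this f
  have h4 : (p.map (Polynomial.C : MvPolynomial (Fin n) F →+* _)).map
      (Polynomial.aeval (R := MvPolynomial (Fin n) F) (ℓ : MvPolynomial (Fin n) F)) ≤ p := by
    rw [Ideal.map_le_iff_le_comap, Ideal.map_le_iff_le_comap]
    intro x hx
    simpa using hx
  have := h4 (Ideal.mem_map_of_mem _ h2)
  rwa [h3] at this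

theorem IsSupportedOn.mem_of_prod_mul_mem {ι : Type*} {K : Submodule F (LinForms F n)}
    {p : Ideal (MvPolynomial (Fin n) F)} (hp : IsSupportedOn K p) (s : Finset ι)
    {ℓ : ι → LinForms F n} (hℓ : ∀ j ∈ s, ℓ j ∉ K) {f : MvPolynomial (Fin n) F}
    (hf : (∏ j ∈ s, (ℓ j : MvPolynomial (Fin n) F)) * f ∈ p) : f ∈ p := by
  classical
  induction s using Finset.induction_on with
  | empty => simpa using hf
  | insert a s ha ih =>
    rw [Finset.prod_insert ha, mul_assoc] at hf
    exact ih (fun j hj => hℓ j (Finset.mem_insert_of_mem hj))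
      (hp.mem_of_form_mul_mem (hℓ a (Finset.mem_insert_self a s)) hf)

theorem prod_isHomogeneous {ι : Type*} (s : Finset ι) (ℓ : ι → LinForms F n) :
    (∏ j ∈ s, (ℓ j : MvPolynomial (Fin n) F)).IsHomogeneous s.card := by
  have := IsHomogeneous.prod s (fun j => (ℓ j : MvPolynomial (Fin n) F)) (fun _ => 1)
    (fun j _ => (ℓ j).2)
  simpa using this

/-- Chinese remaindering: if `D` does not lie in the ideal generated by `p` and a product of
linear forms, then this is witnessed by a subproduct supported on one more form. -/
theorem IsSupportedOn.exists_subproduct {ι : Type*} {K : Submodule F (LinForms F n)}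
    {p : Ideal (MvPolynomial (Fin n) F)} (hp : IsSupportedOn K p) (s : Finset ι)
    (ℓ : ι → LinForms F n) {D : MvPolynomial (Fin n) F}
    (hD : D ∉ p ⊔ Ideal.span {∏ j ∈ s, (ℓ j : MvPolynomial (Fin n) F)}) :
    ∃ (K' : Submodule F (LinForms F n)) (v : MvPolynomial (Fin n) F), K ≤ K' ∧
      Module.finrank F K' ≤ Module.finrank F K + 1 ∧
      v ∣ ∏ j ∈ s, (ℓ j : MvPolynomial (Fin n) F) ∧
      IsSupportedOn K' (p ⊔ Ideal.span {v}) ∧ D ∉ p ⊔ Ideal.span {v} := by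
  classical
  induction s using Finset.strongInduction with
  | H s ih =>
  obtain rfl | ⟨j, hj⟩ := s.eq_empty_or_nonempty
  · simp at hD
  let K' := K ⊔ Submodule.span F {ℓ j}
  have hjK : ℓ j ∈ K' := Submodule.mem_sup_right (Submodule.mem_span_singleton_self _)
  set v := ∏ i ∈ s with ℓ i ∈ K', (ℓ i : MvPolynomial (Fin n) F)
  set w := ∏ i ∈ s with ℓ i ∉ K', (ℓ i : MvPolynomial (Fin n) F)
  have hvw : ∏ i ∈ s, (ℓ i : MvPolynomial (Fin n) F) = v * w :=
    (Finset.prod_filter_mul_prod_filter_not s _ _).symm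
  have hsup : IsSupportedOn K' (p ⊔ Ideal.span {v}) := by
    refine (hp.mono le_sup_left).sup_span_singleton ?_ (prod_isHomogeneous _ ℓ)
    exact prod_mem fun i hi => coe_mem_formAlgebra (Finset.mem_filter.mp hi).2
  by_cases h1 : D ∈ p ⊔ Ideal.span {v}
  · by_cases h2 : D ∈ p ⊔ Ideal.span {w}
    · exfalso
      apply hD
      obtain ⟨a, ha, y, hy, rfl⟩ := Submodule.mem_sup.mp h2
      obtain ⟨c, rfl⟩ := Ideal.mem_span_singleton.mp hy
      have h3 : w * c ∈ p ⊔ Ideal.span {v} :=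
        ((Submodule.add_mem_iff_right _ (Submodule.mem_sup_left ha)).mp h1)
      -- All factors of `w` lie outside `K'`, so `w` is a nonzerodivisor modulo `p + (v)`.
      have h4 := hsup.mem_of_prod_mul_mem _ (fun i hi => (Finset.mem_filter.mp hi).2) h3
      obtain ⟨b, hb, z, hz, rfl⟩ := Submodule.mem_sup.mp h4
      obtain ⟨e, rfl⟩ := Ideal.mem_span_singleton.mp hz
      rw [hvw]
      refine Submodule.mem_sup.mpr ⟨a + w * b, add_mem ha (Ideal.mul_mem_left _ _ hb),
        v * w * e, Ideal.mem_span_singleton.mpr ⟨e, rfl⟩, by ring⟩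
    -- The recursion restarts from `K`, not from `K'`: however deep it goes, only one form is added.
    · obtain ⟨K₁, v₁, h3, h4, h5, h6, h7⟩ := ih (s.filter fun i => ℓ i ∉ K') (by
        refine Finset.filter_ssubset.mpr ⟨j, hj, by simpa using hjK⟩) h2
      exact ⟨K₁, v₁, h3, h4, h5.trans (hvw ▸ Dvd.intro_left _ rfl), h6, h7⟩
  · refine ⟨K', v, le_sup_left, ?_, hvw ▸ Dvd.intro _ rfl, hsup, h1⟩
    refine (Submodule.finrank_add_le_finrank_add_finrank K _).trans ?_
    exact Nat.add_le_add_left ((finrank_span_le_card _).trans (by simp)) _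

theorem homogeneousComponent_mul_eq {σ : Type*} {P : MvPolynomial σ F}
    (hP : P.IsHomogeneous d) (f : MvPolynomial σ F) :
    homogeneousComponent d (P * f) = f.coeff 0 • P := by
  have h : ∀ i, homogeneousComponent d (P * homogeneousComponent i f) =
      if i = 0 then f.coeff 0 • P else 0 := by
    intro i
    have hi : P * homogeneousComponent i f ∈ homogeneousSubmodule σ F (d + i) :=
      hP.mul (homogeneousComponent_isHomogeneous i f)
    rw [homogeneousComponent_of_mem hi]
    by_cases h0 : i = 0
    · subst h0
      simp [MvPolynomial.smul_eq_C_mul, mul_comm]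
    · simp [h0]
  conv_lhs => rw [← sum_homogeneousComponent f]
  rw [Finset.mul_sum, map_sum, Finset.sum_congr rfl fun i _ => h i]
  simp

/-! ### Separating elements of the span of the terms by ideals on few forms -/

namespace Circuit

theorem term_eq_smul (C : Circuit F n k d) (i : Fin k) :
    C.term i = C.coeff i • ∏ j, (C.form i j : MvPolynomial (Fin n) F) := by
  rw [term, MvPolynomial.smul_eq_C_mul]

theorem term_isHomogeneous (C : Circuit F n k d) (i : Fin k) : (C.term i).IsHomogeneous d := by
  rw [term]
  simpa using (prod_isHomogeneous Finset.univ (C.form i)).C_mul (C.coeff i)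

/-- A nonzero form of degree `d` is separated from zero by an ideal supported on few linear forms,
modulo which all the terms are multiples of it. -/
theorem exists_separating_ideal (C : Circuit F n k d) {D : MvPolynomial (Fin n) F}
    (hD : D.IsHomogeneous d) (hD0 : D ≠ 0) (S : Finset (Fin k)) :
    ∃ (K : Submodule F (LinForms F n)) (p : Ideal (MvPolynomial (Fin n) F)),
      Module.finrank F K ≤ S.card ∧ IsSupportedOn K p ∧ D ∉ p ∧
      ∀ i ∈ S, ∃ γ : F, C.term i - γ • D ∈ p := by
  induction S using Finset.induction_on with
  | empty => exact ⟨⊥, ⊥, by simp, isSupportedOn_bot _, by simpa using hD0, by simp⟩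
  | insert i S hi ih =>
    obtain ⟨K, p, hK, hp, hDp, hT⟩ := ih
    rw [Finset.card_insert_of_notMem hi]
    by_cases h : D ∈ p ⊔ Ideal.span {∏ j, (C.form i j : MvPolynomial (Fin n) F)}
    · refine ⟨K, p, hK.trans (Nat.le_succ _), hp, hDp, ?_⟩
      obtain ⟨a, ha, y, hy, hay⟩ := Submodule.mem_sup.mp h
      obtain ⟨f, rfl⟩ := Ideal.mem_span_singleton.mp hy
      set P := ∏ j, (C.form i j : MvPolynomial (Fin n) F) with hPdef
      have hP : P.IsHomogeneous d := by
        simpa using prod_isHomogeneous Finset.univ (C.form i)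
      -- `D` and `P` both have degree `d`, so only the constant term of the cofactor `f` survives in
      -- degree `d`.
      have h1 : homogeneousComponent d a + f.coeff 0 • P = D := by
        rw [← homogeneousComponent_mul_eq hP, ← map_add, hay]
        exact homogeneousComponent_eq_self hD
      have h2 : D - f.coeff 0 • P ∈ p := by
        rw [← h1, add_sub_cancel_right]
        exact hp.homogeneousComponent_mem ha d
      have h3 : f.coeff 0 ≠ 0 := by
        intro h0
        rw [h0, zero_smul, sub_zero] at h2
        exact hDp h2
      intro l hl
      obtain rfl | hl := Finset.mem_insert.mp hl
      · refine ⟨C.coeff l * (f.coeff 0)⁻¹, ?_⟩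
        have : C.term l - (C.coeff l * (f.coeff 0)⁻¹) • D =
            (-(C.coeff l * (f.coeff 0)⁻¹)) • (D - f.coeff 0 • P) := by
          rw [term_eq_smul, smul_sub, smul_smul, neg_mul, mul_assoc, inv_mul_cancel₀ h3, mul_one,
            neg_smul, neg_smul, ← hPdef]
          abel
        rw [this]
        exact Submodule.smul_of_tower_mem _ _ h2
      · exact hT l hl
    · obtain ⟨K', v, hKK', hK', hv, hp', hDp'⟩ := hp.exists_subproduct Finset.univ (C.form i) h
      refine ⟨K', _, by omega, hp', hDp', ?_⟩
      intro l hl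
      obtain rfl | hl := Finset.mem_insert.mp hl
      · refine ⟨0, ?_⟩
        rw [zero_smul, sub_zero]
        exact Submodule.mem_sup_right
          (Ideal.mem_span_singleton.mpr (hv.trans (Dvd.intro_left _ rfl)))
      · obtain ⟨γ, hγ⟩ := hT l hl
        exact ⟨γ, Submodule.mem_sup_left hγ⟩

/-- `p` is supported on `K` and cuts the span of the terms in a hyperplane not containing `D`. -/
def Separates (C : Circuit F n k d) (K : Submodule F (LinForms F n))
    (p : Ideal (MvPolynomial (Fin n) F)) (D : MvPolynomial (Fin n) F) : Prop :=
  IsSupportedOn K p ∧ D ∉ p ∧ ∀ i, ∃ γ : F, C.term i - γ • D ∈ p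

theorem exists_sub_smul_mem (C : Circuit F n k d) {p : Ideal (MvPolynomial (Fin n) F)}
    {D E : MvPolynomial (Fin n) F} (h : ∀ i, ∃ γ : F, C.term i - γ • D ∈ p)
    (hE : E ∈ Submodule.span F (Set.range C.term)) : ∃ γ : F, E - γ • D ∈ p := by
  induction hE using Submodule.span_induction with
  | mem x hx => obtain ⟨i, rfl⟩ := hx; exact h i
  | zero => exact ⟨0, by simp⟩
  | add x y _ _ hx hy =>
    obtain ⟨a, ha⟩ := hx
    obtain ⟨b, hb⟩ := hy
    refine ⟨a + b, ?_⟩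
    rw [add_smul, add_sub_add_comm]
    exact add_mem ha hb
  | smul c x _ hx =>
    obtain ⟨a, ha⟩ := hx
    refine ⟨c * a, ?_⟩
    rw [mul_smul, ← smul_sub]
    exact Submodule.smul_of_tower_mem _ _ ha

theorem span_term_le (C : Circuit F n k d) :
    Submodule.span F (Set.range C.term) ≤ homogeneousSubmodule (Fin n) F d := by
  refine Submodule.span_le.mpr ?_
  rintro _ ⟨i, rfl⟩
  exact C.term_isHomogeneous i

/-- A single small space of linear forms supports ideals separating all nonzero elements of a
subspace of the span of the terms. -/
theorem exists_separating_space (C : Circuit F n k d)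
    (U : Submodule F (MvPolynomial (Fin n) F)) (hU : U ≤ Submodule.span F (Set.range C.term)) :
    ∃ K : Submodule F (LinForms F n), Module.finrank F K ≤ Module.finrank F U * k ∧
      ∀ D ∈ U, D ≠ 0 → ∃ p, C.Separates K p D := by
  induction hr : Module.finrank F U using Nat.strong_induction_on generalizing U with
  | _ r ih =>
  by_cases hbot : U = ⊥
  · subst hbot
    exact ⟨⊥, by simp, fun D hD h => absurd hD h⟩
  obtain ⟨D₀, hD₀, hD₀0⟩ := Submodule.exists_mem_ne_zero_of_ne_bot hbot
  obtain ⟨K₀, p, hK₀, hp, hDp, hT⟩ :=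
    C.exists_separating_ideal (C.span_term_le (hU hD₀)) hD₀0 Finset.univ
  rw [Finset.card_univ, Fintype.card_fin] at hK₀
  have hfin : FiniteDimensional F U := by
    have : FiniteDimensional F (Submodule.span F (Set.range C.term)) :=
      FiniteDimensional.span_of_finite F (Set.finite_range _)
    exact Submodule.finiteDimensional_of_le hU
  -- An element of `U` outside `p` is a nonzero multiple of `D₀` modulo `p`, so `p` already
  -- separates it. Only the elements in `p` need further ideals.
  let U' : Submodule F (MvPolynomial (Fin n) F) := U ⊓ p.restrictScalars F
  have hlt : U' < U := by
    refine lt_of_le_of_ne inf_le_left fun h => hDp ?_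
    rw [← h] at hD₀
    exact hD₀.2
  have hrk := Submodule.finrank_lt_finrank_of_lt hlt
  obtain ⟨K₁, hK₁, hK₁'⟩ := ih _ (hr ▸ hrk) U' (inf_le_left.trans hU) rfl
  refine ⟨K₀ ⊔ K₁, ?_, ?_⟩
  · refine (Submodule.finrank_add_le_finrank_add_finrank K₀ K₁).trans ?_
    have : (Module.finrank F U' + 1) * k ≤ r * k := Nat.mul_le_mul_right k (by omega)
    rw [add_mul, one_mul] at this
    omega
  · intro D hD hD0
    by_cases hDU : D ∈ p
    · obtain ⟨p', h1, h2, h3⟩ := hK₁' D ⟨hD, hDU⟩ hD0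
      exact ⟨p', h1.mono le_sup_right, h2, h3⟩
    · refine ⟨p, hp.mono le_sup_left, hDU, fun i => ?_⟩
      obtain ⟨γ, hγ⟩ := C.exists_sub_smul_mem (fun i => hT i (Finset.mem_univ i)) (hU hD)
      obtain ⟨δ, hδ⟩ := hT i (Finset.mem_univ i)
      have hγ0 : γ ≠ 0 := by
        rintro rfl
        rw [zero_smul, sub_zero] at hγ
        exact hDU hγ
      refine ⟨δ * γ⁻¹, ?_⟩
      have : C.term i - (δ * γ⁻¹) • D =
          (C.term i - δ • D₀) - (δ * γ⁻¹) • (D - γ • D₀) := by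
        rw [smul_sub, smul_smul, mul_assoc, inv_mul_cancel₀ hγ0, mul_one]
        abel
      rw [this]
      exact sub_mem hδ (Submodule.smul_of_tower_mem _ _ hγ)

end Circuit

/-! ### Leading parts modulo a space of forms -/

theorem exists_endomorphism_ker_eq {L : Type*} [AddCommGroup L] [Module F L]
    (K : Submodule F L) : ∃ q : L →ₗ[F] L, ∀ x, q x = 0 ↔ x ∈ K := by
  obtain ⟨s, hs⟩ := K.mkQ.exists_rightInverse_of_surjective K.range_mkQ
  have hs' : ∀ y, K.mkQ (s y) = y := fun y => DFunLike.congr_fun hs y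
  refine ⟨s ∘ₗ K.mkQ, fun x => ?_⟩
  rw [LinearMap.comp_apply, ← Submodule.Quotient.mk_eq_zero, ← Submodule.mkQ_apply]
  refine ⟨fun h => ?_, fun h => by rw [h, map_zero]⟩
  rw [← hs' (K.mkQ x), h, map_zero]

section Pencil

variable {A : Type*} [CommRing A] [Algebra F A]

/-- The linear map `x ↦ a x + b x * t`. -/
def pencilLin (a b : LinForms F n →ₗ[F] A) : LinForms F n →ₗ[F] Polynomial A where
  toFun x := Polynomial.C (a x) + Polynomial.C (b x) * Polynomial.X
  map_add' x y := by
    simp only [map_add]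
    ring
  map_smul' c x := by
    simp only [map_smul, RingHom.id_apply, Algebra.smul_def, map_mul, Polynomial.algebraMap_apply]
    ring

/-- The coefficient of `t ^ e` under the homomorphism extending `x ↦ a x + b x * t`. -/
def pencilCoeff (a b : LinForms F n →ₗ[F] A) (e : ℕ) : MvPolynomial (Fin n) F →ₗ[F] A :=
  ((Polynomial.lcoeff A e).restrictScalars F) ∘ₗ (liftLin (pencilLin a b)).toLinearMap

theorem pencilCoeff_apply (a b : LinForms F n →ₗ[F] A) (e : ℕ) (f : MvPolynomial (Fin n) F) :
    pencilCoeff a b e f = (liftLin (pencilLin a b) f).coeff e := rfl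

theorem liftLin_pencilLin_coe (a b : LinForms F n →ₗ[F] A) (x : LinForms F n) :
    liftLin (pencilLin a b) x = Polynomial.C (a x) + Polynomial.C (b x) * Polynomial.X :=
  liftLin_coe _ x

-- Forms in `K` are constant in `t` and the others have degree at most one in `t`. Hence for `e` at
-- least the number of forms outside `K`, only the top coefficient can contribute.
open Classical in
theorem pencilCoeff_prod {ι : Type*} {K : Submodule F (LinForms F n)}
    {a b : LinForms F n →ₗ[F] A} (hb : ∀ x ∈ K, b x = 0)
    (s : Finset ι) (ℓ : ι → LinForms F n) {e : ℕ} (he : {j ∈ s | ℓ j ∉ K}.card ≤ e) :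
    pencilCoeff a b e (∏ j ∈ s, (ℓ j : MvPolynomial (Fin n) F)) =
      if {j ∈ s | ℓ j ∉ K}.card = e then
        (∏ j ∈ s with ℓ j ∈ K, a (ℓ j)) * ∏ j ∈ s with ℓ j ∉ K, b (ℓ j)
      else 0 := by
  have h1 : liftLin (pencilLin a b) (∏ j ∈ s, (ℓ j : MvPolynomial (Fin n) F)) =
      Polynomial.C (∏ j ∈ s with ℓ j ∈ K, a (ℓ j)) *
        ∏ j ∈ s with ℓ j ∉ K, liftLin (pencilLin a b) (ℓ j) := by
    rw [← Finset.prod_filter_mul_prod_filter_not s (fun j => ℓ j ∈ K), map_mul, map_prod, map_prod,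
      map_prod]
    congr 1
    refine Finset.prod_congr rfl fun j hj => ?_
    rw [liftLin_pencilLin_coe, hb _ (Finset.mem_filter.mp hj).2]
    simp
  have hdeg : ∀ j, (liftLin (pencilLin a b) (ℓ j)).natDegree ≤ 1 := by
    intro j
    rw [liftLin_pencilLin_coe, add_comm]
    exact Polynomial.natDegree_linear_le
  rw [pencilCoeff_apply, h1, Polynomial.coeff_C_mul]
  split_ifs with h
  · congr 1
    have := Polynomial.coeff_prod_of_natDegree_le {j ∈ s | ℓ j ∉ K}
      (fun j => liftLin (pencilLin a b) (ℓ j)) 1 (fun j _ => hdeg j)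
    rw [mul_one, h] at this
    rw [this]
    refine Finset.prod_congr rfl fun j _ => ?_
    rw [liftLin_pencilLin_coe]
    simp [Polynomial.coeff_C]
  · rw [Polynomial.coeff_eq_zero_of_natDegree_lt, mul_zero]
    refine lt_of_le_of_lt ?_ (lt_of_le_of_ne he h)
    refine (Polynomial.natDegree_prod_le _ _).trans ?_
    exact (Finset.sum_le_card_nsmul _ _ 1 fun j _ => hdeg j).trans (by simp)

/-- On `K` the pencil is the constant map `c`, so the generators of `p` acquire no `t`. Membership
in the extended ideal is then read off coefficientwise. -/
theorem IsSupportedOn.pencilCoeff_mem {K : Submodule F (LinForms F n)}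
    {a b : LinForms F n →ₗ[F] A} (hb : ∀ x ∈ K, b x = 0)
    {c : MvPolynomial (Fin n) F →ₐ[F] A} (ha : ∀ x ∈ K, a x = c x)
    {p : Ideal (MvPolynomial (Fin n) F)} (hp : IsSupportedOn K p)
    {f : MvPolynomial (Fin n) F} (hf : f ∈ p) (e : ℕ) : pencilCoeff a b e f ∈ p.map c := by
  have h1 : liftLin (pencilLin a b) f ∈ p.map ((Polynomial.CAlgHom (R := F)).comp c) := by
    refine hp.liftLin_mem (fun x hx => ?_) hf
    rw [← liftLin_coe, liftLin_pencilLin_coe, hb x hx, ha x hx]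
    simp
  have h2 : p.map ((Polynomial.CAlgHom (R := F)).comp c) ≤ (p.map c).map Polynomial.C := by
    rw [Ideal.map_le_iff_le_comap]
    intro x hx
    exact Ideal.mem_map_of_mem _ (Ideal.mem_map_of_mem c hx)
  exact Ideal.mem_map_C_iff.mp (h2 h1) e

end Pencil

/-- The part of a polynomial of degree `e` in the image of the linear map `q`, which is put into
a second set of variables. -/
def splitCoeff (q : LinForms F n →ₗ[F] LinForms F n) (e : ℕ) :
    MvPolynomial (Fin n) F →ₗ[F] MvPolynomial (Fin n) (MvPolynomial (Fin n) F) :=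
  pencilCoeff (A := MvPolynomial (Fin n) (MvPolynomial (Fin n) F))
    ((IsScalarTower.toAlgHom F (MvPolynomial (Fin n) F) _).toLinearMap ∘ₗ
      Submodule.subtype _ ∘ₗ (LinearMap.id - q))
    ((mapAlgHom (Algebra.ofId F (MvPolynomial (Fin n) F))).toLinearMap ∘ₗ
      Submodule.subtype _ ∘ₗ q) e

open Classical in
theorem splitCoeff_prod {ι : Type*} {K : Submodule F (LinForms F n)}
    {q : LinForms F n →ₗ[F] LinForms F n} (hq : ∀ x, q x = 0 ↔ x ∈ K)
    (s : Finset ι) (ℓ : ι → LinForms F n) {e : ℕ} (he : {j ∈ s | ℓ j ∉ K}.card ≤ e) :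
    splitCoeff q e (∏ j ∈ s, (ℓ j : MvPolynomial (Fin n) F)) =
      if {j ∈ s | ℓ j ∉ K}.card = e then
        C (∏ j ∈ s with ℓ j ∈ K, (ℓ j : MvPolynomial (Fin n) F)) *
          map (algebraMap F (MvPolynomial (Fin n) F))
            (∏ j ∈ s with ℓ j ∉ K, (q (ℓ j) : MvPolynomial (Fin n) F))
      else 0 := by
  rw [splitCoeff, pencilCoeff_prod (K := K) (fun x hx => by simp [(hq x).mpr hx]) s ℓ he]
  refine if_congr Iff.rfl ?_ rfl
  rw [map_prod, map_prod]
  congr 1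
  refine Finset.prod_congr rfl fun j hj => ?_
  simp [(hq _).mpr (Finset.mem_filter.mp hj).2, MvPolynomial.algebraMap_eq]

/-- This transfers a congruence modulo `p` to leading parts: the factors outside `K` move to fresh
variables, and each of their monomials yields a congruence between the parts in `K`. -/
theorem IsSupportedOn.coeff_splitCoeff_mem {K : Submodule F (LinForms F n)}
    {q : LinForms F n →ₗ[F] LinForms F n} (hq : ∀ x, q x = 0 ↔ x ∈ K)
    {p : Ideal (MvPolynomial (Fin n) F)} (hp : IsSupportedOn K p)
    {f : MvPolynomial (Fin n) F} (hf : f ∈ p) (e : ℕ) (m : Fin n →₀ ℕ) :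
    (splitCoeff q e f).coeff m ∈ p := by
  have h := hp.pencilCoeff_mem (A := MvPolynomial (Fin n) (MvPolynomial (Fin n) F))
    (a := (IsScalarTower.toAlgHom F (MvPolynomial (Fin n) F) _).toLinearMap ∘ₗ
      Submodule.subtype _ ∘ₗ (LinearMap.id - q))
    (b := (mapAlgHom (Algebra.ofId F (MvPolynomial (Fin n) F))).toLinearMap ∘ₗ
      Submodule.subtype _ ∘ₗ q)
    (fun x hx => by simp [(hq x).mpr hx])
    (c := IsScalarTower.toAlgHom F (MvPolynomial (Fin n) F) _)
    (fun x hx => by simp [(hq x).mpr hx]) hf e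
  exact MvPolynomial.mem_map_C_iff.mp h m

/-! ### From congruence modulo an ideal to matchings, by unique factorization -/

open Classical in
theorem exists_equiv_associated {ι R : Type*} [Fintype ι] [CommRing R] [IsDomain R]
    [UniqueFactorizationMonoid R] (a b : ι → R) (ha : ∀ j, a j ≠ 0 → Irreducible (a j))
    (hb : ∀ j, b j ≠ 0 → Irreducible (b j))
    (h : Associated (∏ j with a j ≠ 0, a j) (∏ j with b j ≠ 0, b j)) :
    ∃ σ : ι ≃ ι, ∀ j, Associated (a j) (b (σ j)) := by
  have hrel : Multiset.Rel Associated (Multiset.map a (Finset.univ.filter fun j => a j ≠ 0).val)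
      (Multiset.map b (Finset.univ.filter fun j => b j ≠ 0).val) := by
    refine UniqueFactorizationMonoid.factors_unique ?_ ?_ (by simpa [Finset.prod] using h)
    · intro x hx
      obtain ⟨j, hj, rfl⟩ := Multiset.mem_map.mp hx
      exact ha j (by simpa using hj)
    · intro x hx
      obtain ⟨j, hj, rfl⟩ := Multiset.mem_map.mp hx
      exact hb j (by simpa using hj)
  rw [Associates.rel_associated_iff_map_eq_map, Multiset.map_map, Multiset.map_map] at hrel
  have key : ∀ c : Associates R, c ≠ 0 → ∀ f : ι → R,
      Multiset.count c (Multiset.map (Associates.mk ∘ f) (Finset.univ.filter fun j => f j ≠ 0).val) =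
        Fintype.card {j // Associates.mk (f j) = c} := by
    intro c hc f
    rw [Multiset.count_map, Fintype.card_subtype, Finset.card_def]
    congr 1
    rw [← Finset.filter_val, Finset.val_inj]
    ext j
    simp only [Finset.mem_filter, Function.comp_apply, Finset.mem_univ, true_and]
    refine ⟨fun h => h.2.symm, fun h => ⟨fun h0 => hc ?_, h.symm⟩⟩
    rw [← h, h0, Associates.mk_zero]
  -- The zero entries, which later are the forms in `K`, do not enter the factorization. Their
  -- number is the complement of the number of nonzero entries, so it also agrees for `a` and `b`.
  have hzero : ∀ f : ι → R, Fintype.card {j // Associates.mk (f j) = 0} +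
      Multiset.card (Multiset.map (Associates.mk ∘ f) (Finset.univ.filter fun j => f j ≠ 0).val) =
        Fintype.card ι := by
    intro f
    rw [Multiset.card_map, Fintype.card_subtype, ← Finset.card_def, ← Finset.card_univ]
    rw [← Finset.card_filter_add_card_filter_not (s := Finset.univ)
      (fun j => Associates.mk (f j) = 0)]
    congr 2
    ext j
    simp
  have hcard : ∀ c : Associates R, Fintype.card {j // Associates.mk (a j) = c} =
      Fintype.card {j // Associates.mk (b j) = c} := by
    intro c
    by_cases hc : c = 0
    · subst hc
      have h1 := hzero a
      have h2 := hzero b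
      rw [hrel] at h1
      omega
    · rw [← key c hc, ← key c hc, hrel]
  let σ : ι ≃ ι := Equiv.ofFiberEquiv fun c => Fintype.equivOfCardEq (hcard c)
  refine ⟨σ, fun j => ?_⟩
  have := Equiv.ofFiberEquiv_map (fun c => Fintype.equivOfCardEq (hcard c)) j
  exact (Associates.mk_eq_mk_iff_associated.mp this).symm

theorem irreducible_form {x : LinForms F n} (hx : x ≠ 0) :
    Irreducible (x : MvPolynomial (Fin n) F) := by
  have hx' : (x : MvPolynomial (Fin n) F) ≠ 0 := by simpa using hx
  refine irreducible_of_totalDegree_eq_one (IsHomogeneous.totalDegree x.2 hx') ?_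
  intro c hc
  rw [isUnit_iff_ne_zero]
  rintro rfl
  apply hx'
  ext m
  simpa using hc m

theorem exists_smul_of_associated {x y : LinForms F n}
    (h : Associated (x : MvPolynomial (Fin n) F) (y : MvPolynomial (Fin n) F)) :
    ∃ c : F, c ≠ 0 ∧ y = c • x := by
  obtain ⟨u, hu⟩ := h
  obtain ⟨c, hc, huc⟩ := isUnit_iff_eq_C_of_isReduced.mp u.isUnit
  refine ⟨c, hc.ne_zero, Subtype.ext ?_⟩
  rw [← hu, huc, Submodule.coe_smul, MvPolynomial.smul_eq_C_mul, mul_comm]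

theorem coeff_C_mul_map (N M : MvPolynomial (Fin n) F) (m : Fin n →₀ ℕ) :
    (C N * map (algebraMap F (MvPolynomial (Fin n) F)) M).coeff m = M.coeff m • N := by
  rw [coeff_C_mul, coeff_map, Algebra.smul_def, mul_comm]

theorem mem_of_smul_mem {p : Ideal (MvPolynomial (Fin n) F)} {c : F} (hc : c ≠ 0)
    {f : MvPolynomial (Fin n) F} (h : c • f ∈ p) : f ∈ p := by
  have := Submodule.smul_of_tower_mem p c⁻¹ h
  rwa [smul_smul, inv_mul_cancel₀ hc, one_smul] at this

theorem prod_form_ne_zero {ι : Type*} {s : Finset ι} {x : ι → LinForms F n}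
    (h : ∀ j ∈ s, x j ≠ 0) : ∏ j ∈ s, (x j : MvPolynomial (Fin n) F) ≠ 0 :=
  Finset.prod_ne_zero_iff.mpr fun j hj => by simpa using h j hj

/-- Products of linear forms that are nonzero and proportional modulo an ideal supported on `K`
are `K`-matched. -/
theorem IsSupportedOn.exists_matching {K : Submodule F (LinForms F n)}
    {p : Ideal (MvPolynomial (Fin n) F)} (hp : IsSupportedOn K p) {ℓ ℓ' : Fin d → LinForms F n}
    {γ : F} (h : ∏ j, (ℓ j : MvPolynomial (Fin n) F) -
      γ • ∏ j, (ℓ' j : MvPolynomial (Fin n) F) ∈ p)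
    (hT : ∏ j, (ℓ j : MvPolynomial (Fin n) F) ∉ p) : ∃ π, IsMatching K ℓ ℓ' π := by
  classical
  obtain ⟨q, hq⟩ := exists_endomorphism_ker_eq K
  have hγ : γ ≠ 0 := by
    rintro rfl
    rw [zero_smul, sub_zero] at h
    exact hT h
  have hT' : ∏ j, (ℓ' j : MvPolynomial (Fin n) F) ∉ p := fun h' =>
    hT ((Submodule.sub_mem_iff_left _ (Submodule.smul_of_tower_mem p γ h')).mp h)
  have hN : ∀ f : Fin d → LinForms F n, ∏ j, (f j : MvPolynomial (Fin n) F) ∉ p →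
      ∏ j with f j ∈ K, (f j : MvPolynomial (Fin n) F) ∉ p := by
    intro f hf h'
    apply hf
    rw [← Finset.prod_filter_mul_prod_filter_not Finset.univ (fun j => f j ∈ K)]
    exact Ideal.mul_mem_right _ _ h'
  have hM : ∀ f : Fin d → LinForms F n,
      ∏ j with f j ∉ K, (q (f j) : MvPolynomial (Fin n) F) ≠ 0 := fun f =>
    prod_form_ne_zero fun j hj h0 => (Finset.mem_filter.mp hj).2 ((hq _).mp h0)
  have hmem := fun e m => hp.coeff_splitCoeff_mem hq h e m
  simp only [map_sub, map_smul] at hmem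
  obtain hlt | heq | hgt := lt_trichotomy (Finset.univ.filter fun j => ℓ j ∉ K).card (Finset.univ.filter fun j => ℓ' j ∉ K).card
  -- With unequal numbers of outside forms, only the larger product survives in the top degree,
  -- which puts its part in `K`, and so the product itself, into `p`.
  · exfalso
    obtain ⟨m, hm⟩ := ne_zero_iff.mp (hM ℓ')
    have := hmem (Finset.univ.filter fun j => ℓ' j ∉ K).card m
    rw [splitCoeff_prod hq _ _ hlt.le, splitCoeff_prod hq _ _ le_rfl, if_neg hlt.ne, if_pos rfl,
      zero_sub, coeff_neg, coeff_smul, coeff_C_mul_map, neg_mem_iff] at this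
    exact hN ℓ' hT' (mem_of_smul_mem hm (mem_of_smul_mem hγ this))
  · have hmem' := hmem (Finset.univ.filter fun j => ℓ j ∉ K).card
    rw [splitCoeff_prod hq _ _ le_rfl, splitCoeff_prod hq _ _ heq.ge, if_pos rfl,
      if_pos heq.symm] at hmem'
    simp only [coeff_sub, coeff_smul, coeff_C_mul_map] at hmem'
    set N := ∏ j with ℓ j ∈ K, (ℓ j : MvPolynomial (Fin n) F)
    set N' := ∏ j with ℓ' j ∈ K, (ℓ' j : MvPolynomial (Fin n) F)
    set M := ∏ j with ℓ j ∉ K, (q (ℓ j) : MvPolynomial (Fin n) F) with hMdef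
    set M' := ∏ j with ℓ' j ∉ K, (q (ℓ' j) : MvPolynomial (Fin n) F) with hMdef'
    obtain ⟨m, hm⟩ := ne_zero_iff.mp (hM ℓ)
    -- Cross-multiplying the congruences at `m` and `m'` eliminates `N`. Since `N' ∉ p`, the scalar
    -- left in front of it vanishes, which makes `M` and `M'` proportional.
    have h1 : ∀ m', (M.coeff m * (γ * M'.coeff m') - M.coeff m' * (γ * M'.coeff m)) • N' ∈ p := by
      intro m'
      have e1 := Submodule.smul_of_tower_mem p (M.coeff m') (hmem' m)
      have e2 := Submodule.smul_of_tower_mem p (M.coeff m) (hmem' m')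
      have e3 := sub_mem e1 e2
      convert e3 using 1
      simp only [smul_sub, smul_smul, sub_smul]
      rw [mul_comm (M.coeff m') (M.coeff m)]
      abel
    have h2 : ∀ m', M.coeff m * (γ * M'.coeff m') = M.coeff m' * (γ * M'.coeff m) := by
      intro m'
      by_contra hne
      exact hN ℓ' hT' (mem_of_smul_mem (sub_ne_zero.mpr hne) (h1 m'))
    have h3 : (M.coeff m * γ) • M' = (γ * M'.coeff m) • M := by
      ext m'
      rw [coeff_smul, coeff_smul, smul_eq_mul, smul_eq_mul, mul_assoc, h2 m', mul_comm]
    have h4 : γ * M'.coeff m ≠ 0 := by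
      intro h0
      rw [h0, zero_smul] at h3
      exact hM ℓ' ((smul_eq_zero.mp h3).resolve_left (mul_ne_zero hm hγ))
    have hassoc : Associated M M' := by
      have hu : ∀ {c : F} (hc : c ≠ 0) (f : MvPolynomial (Fin n) F), Associated f (c • f) := by
        intro c hc f
        refine ⟨((isUnit_iff_ne_zero.mpr hc).map C).unit, ?_⟩
        rw [IsUnit.unit_spec, MvPolynomial.smul_eq_C_mul, mul_comm]
      exact (hu h4 M).trans (h3 ▸ (hu (mul_ne_zero hm hγ) M').symm)
    have hne : ∀ f : Fin d → LinForms F n, ∀ j,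
        (q (f j) : MvPolynomial (Fin n) F) ≠ 0 ↔ f j ∉ K := by
      intro f j
      rw [← hq (f j)]
      simp
    obtain ⟨π, hπ⟩ := exists_equiv_associated (fun j => (q (ℓ j) : MvPolynomial (Fin n) F))
      (fun j => (q (ℓ' j) : MvPolynomial (Fin n) F))
      (fun j hj => irreducible_form (by simpa using hj))
      (fun j hj => irreducible_form (by simpa using hj)) (by
        rw [hMdef, hMdef'] at hassoc
        simp only [hne]
        exact hassoc)
    refine ⟨π, fun j => ?_⟩
    obtain ⟨c, hc, hcx⟩ := exists_smul_of_associated (hπ j)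
    refine ⟨c, hc, ℓ' (π j) - c • ℓ j, ?_, by abel⟩
    rw [← hq, map_sub, map_smul, hcx, sub_self]
  · exfalso
    obtain ⟨m, hm⟩ := ne_zero_iff.mp (hM ℓ)
    have := hmem (Finset.univ.filter fun j => ℓ j ∉ K).card m
    rw [splitCoeff_prod hq _ _ le_rfl, splitCoeff_prod hq _ _ hgt.le, if_neg hgt.ne, if_pos rfl,
      smul_zero, sub_zero, coeff_C_mul_map] at this
    exact hN ℓ hT (mem_of_smul_mem hm this)

/-! ### Calculus of matchings -/

section Matching

variable {M ι κ τ : Type*} [AddCommGroup M] [Module F M] {K K' : Submodule F M}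
  {U : ι → M} {V : κ → M} {W : τ → M} {π : ι ≃ κ} {ρ : κ ≃ τ}

theorem IsMatching.refl (K : Submodule F M) (U : ι → M) : IsMatching K U U (Equiv.refl ι) :=
  fun _ => ⟨1, one_ne_zero, 0, zero_mem _, by simp⟩

theorem IsMatching.trans (h : IsMatching K U V π) (h' : IsMatching K V W ρ) :
    IsMatching K U W (π.trans ρ) := by
  intro j
  obtain ⟨a, ha, v, hv, e⟩ := h j
  obtain ⟨b, hb, w, hw, e'⟩ := h' (π j)
  refine ⟨b * a, mul_ne_zero hb ha, b • v + w, add_mem (K.smul_mem b hv) hw, ?_⟩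
  rw [Equiv.trans_apply, e', e, smul_add, smul_smul, add_assoc]

theorem IsMatching.mono (hK : K ≤ K') (h : IsMatching K U V π) : IsMatching K' U V π := by
  intro j
  obtain ⟨a, ha, v, hv, e⟩ := h j
  exact ⟨a, ha, v, hK hv, e⟩

theorem IsMatching.mem_iff (h : IsMatching K U V π) (j : ι) : V (π j) ∈ K ↔ U j ∈ K := by
  obtain ⟨a, ha, v, hv, e⟩ := h j
  rw [e, Submodule.add_mem_iff_left _ hv, Submodule.smul_mem_iff _ ha]

end Matching

open Classical in
theorem IsMatching.card_eq {K : Submodule F (LinForms F n)} {ℓ ℓ' : Fin d → LinForms F n}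
    {π : Fin d ≃ Fin d} (h : IsMatching K ℓ ℓ' π) :
    (Finset.univ.filter fun j => ℓ' j ∉ K).card = (Finset.univ.filter fun j => ℓ j ∉ K).card := by
  symm
  refine Finset.card_bij (fun j _ => π j) ?_ (fun _ _ _ _ e => π.injective e) ?_
  · intro j hj
    simpa [h.mem_iff] using hj
  · intro j hj
    refine ⟨π.symm j, ?_, by simp⟩
    have := h.mem_iff (π.symm j)
    simp only [Equiv.apply_symm_apply] at this
    simpa [← this] using hj

open Classical in
theorem IsMatching.exists_prod_eq {K : Submodule F (LinForms F n)} {ℓ ℓ' : Fin d → LinForms F n}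
    {π : Fin d ≃ Fin d} (h : IsMatching K ℓ ℓ' π) {q : LinForms F n →ₗ[F] LinForms F n}
    (hq : ∀ x, q x = 0 ↔ x ∈ K) :
    ∃ c : F, c ≠ 0 ∧ ∏ j with ℓ' j ∉ K, (q (ℓ' j) : MvPolynomial (Fin n) F) =
      c • ∏ j with ℓ j ∉ K, (q (ℓ j) : MvPolynomial (Fin n) F) := by
  choose a ha v hv e using h
  refine ⟨∏ j with ℓ j ∉ K, a j, Finset.prod_ne_zero_iff.mpr fun j _ => ha j, ?_⟩
  rw [Finset.prod_filter, Finset.prod_filter, Finset.prod_filter, ← Equiv.prod_comp π,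
    MvPolynomial.smul_eq_C_mul, map_prod, ← Finset.prod_mul_distrib]
  refine Finset.prod_congr rfl fun j _ => ?_
  have h1 : ℓ' (π j) ∈ K ↔ ℓ j ∈ K :=
    IsMatching.mem_iff (π := π) (fun j => ⟨a j, ha j, v j, hv j, e j⟩) j
  by_cases hj : ℓ j ∈ K
  · simp [h1, hj]
  · rw [if_pos (h1.not.mpr hj), if_pos hj, if_pos hj, e, map_add, map_smul, (hq _).mpr (hv j),
      add_zero, Submodule.coe_smul, MvPolynomial.smul_eq_C_mul]

/-! ### Existence of a nucleus -/

namespace Circuit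

/-- For a matched circuit, the leading parts of the terms modulo `K` are the parts of the terms
in `K` times scalars and a common factor. -/
theorem exists_splitCoeff_term [NeZero k] (C : Circuit F n k d) {K : Submodule F (LinForms F n)}
    (hK : ∀ i, ∃ π : Fin d ≃ Fin d, IsMatching K (C.form 0) (C.form i) π) :
    ∃ (q : LinForms F n →ₗ[F] LinForms F n) (e : ℕ) (M : MvPolynomial (Fin n) F) (δ : Fin k → F),
      (∀ x, q x = 0 ↔ x ∈ K) ∧ M ≠ 0 ∧ (∀ i, δ i ≠ 0) ∧
      ∀ i, splitCoeff q e (C.term i) = MvPolynomial.C (δ i • C.nucleusTerm K i) *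
        map (algebraMap F (MvPolynomial (Fin n) F)) M := by
  classical
  obtain ⟨q, hq⟩ := exists_endomorphism_ker_eq K
  choose π hπ using hK
  choose c hc hcM using fun i => (hπ i).exists_prod_eq hq
  refine ⟨q, (Finset.univ.filter fun j => C.form 0 j ∉ K).card, _, fun i => C.coeff i * c i, hq,
    prod_form_ne_zero (s := {j | C.form 0 j ∉ K}) (x := fun j => q (C.form 0 j))
      fun j hj h0 => (Finset.mem_filter.mp hj).2 ((hq _).mp h0),
    fun i => mul_ne_zero (C.coeff_ne_zero i) (hc i), fun i => ?_⟩
  have hcard := (hπ i).card_eq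
  rw [term_eq_smul, map_smul, splitCoeff_prod hq _ _ hcard.le, if_pos hcard, hcM i]
  ext1 m
  rw [coeff_smul, coeff_C_mul_map, coeff_C_mul_map, coeff_smul, smul_smul, smul_smul, smul_eq_mul,
    nucleusTerm]
  congr 1
  ring

/-- The leading parts share the nonzero factor `M`, which cancels from the leading part of the
identity. Only the matching is needed, not a bound on `dim K`, so this also applies to spaces larger
than a nucleus. -/
theorem sum_smul_nucleusTerm_eq_zero [NeZero k] (C : Circuit F n k d)
    (hzero : C.IsIdentity) {K : Submodule F (LinForms F n)}
    (hK : ∀ i, ∃ π : Fin d ≃ Fin d, IsMatching K (C.form 0) (C.form i) π) :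
    ∃ δ : Fin k → F, (∀ i, δ i ≠ 0) ∧ ∑ i, δ i • C.nucleusTerm K i = 0 := by
  obtain ⟨q, e, M, δ, hq, hM, hδ, h⟩ := C.exists_splitCoeff_term hK
  refine ⟨δ, hδ, ?_⟩
  have h0 : splitCoeff q e (∑ i, C.term i) = 0 := by
    rw [hzero, map_zero]
  rw [map_sum, Finset.sum_congr rfl fun i _ => h i, ← Finset.sum_mul, ← map_sum] at h0
  obtain ⟨m, hm⟩ := ne_zero_iff.mp hM
  have h1 := congrArg (MvPolynomial.coeff m) h0
  rw [coeff_C_mul_map, coeff_zero] at h1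
  exact (smul_eq_zero.mp h1).resolve_left hm

/-- All linear relations between the terms are multiples of the identity. -/
theorem relation_eq (C : Circuit F n k d) (hzero : C.IsIdentity) (hmin : C.IsStronglyMinimal)
    {α : Fin k → F} (hα : ∑ i, α i • C.term i = 0) (i j : Fin k) : α i = α j := by
  have hk : 0 < k := i.pos
  let l : Fin k := ⟨k - 1, by omega⟩
  suffices h : ∀ i, α i = α l by rw [h i, h j]
  intro i
  -- Subtracting `α l` times the identity removes the last term and leaves a relation between
  -- independent terms.
  have h1 : ∑ i, (α i - α l) • C.term i = 0 := by
    simp only [sub_smul, Finset.sum_sub_distrib]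
    rw [hα, ← Finset.smul_sum, hzero, smul_zero, sub_zero]
  by_cases hil : i = l
  · rw [hil]
  have hlt : ∀ i : Fin k, i ≠ l → (i : ℕ) + 1 < k := by
    intro i hi
    have : (i : ℕ) ≠ k - 1 := fun h => hi (Fin.ext h)
    omega
  have h2 := linearIndepOn_iff'.mp hmin (Finset.univ.erase l) (fun i => α i - α l)
    (fun i hi => hlt i (by simpa using hi)) (by
      rw [Finset.sum_erase _ (by simp)]
      exact h1)
  exact sub_eq_zero.mp (h2 i (by simpa using hil))

theorem sum_term_ne_zero (C : Circuit F n k d) (hzero : C.IsIdentity)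
    (hmin : C.IsStronglyMinimal) {S : Finset (Fin k)} {i j : Fin k} (hi : i ∈ S) (hj : j ∉ S) :
    ∑ i ∈ S, C.term i ≠ 0 := by
  classical
  intro h
  have := C.relation_eq hzero hmin (α := fun i => if i ∈ S then 1 else 0) (by simpa using h) i j
  simp [hi, hj] at this

theorem term_mem_iff (C : Circuit F n k d) (i : Fin k) (p : Ideal (MvPolynomial (Fin n) F)) :
    C.term i ∈ p ↔ ∏ j, (C.form i j : MvPolynomial (Fin n) F) ∈ p := by
  rw [term_eq_smul]
  exact ⟨mem_of_smul_mem (C.coeff_ne_zero i), Submodule.smul_of_tower_mem p _⟩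

/-- Both terms are nonzero multiples of `D` modulo `p`, hence of each other. -/
theorem exists_matching_of_separates (C : Circuit F n k d) {K : Submodule F (LinForms F n)}
    {p : Ideal (MvPolynomial (Fin n) F)} {D : MvPolynomial (Fin n) F} (h : C.Separates K p D)
    {i j : Fin k} (hi : C.term i ∉ p) (hj : C.term j ∉ p) :
    ∃ π, IsMatching K (C.form i) (C.form j) π := by
  obtain ⟨hp, hD, hT⟩ := h
  obtain ⟨a, ha⟩ := hT i
  obtain ⟨b, hb⟩ := hT j
  have hb0 : b ≠ 0 := by
    rintro rfl
    rw [zero_smul, sub_zero] at hb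
    exact hj hb
  rw [term_mem_iff] at hi
  have hci := C.coeff_ne_zero i
  refine hp.exists_matching (γ := (C.coeff i)⁻¹ * a * b⁻¹ * C.coeff j) ?_ hi
  have h1 := sub_mem (Submodule.smul_of_tower_mem p (C.coeff i)⁻¹ ha)
    (Submodule.smul_of_tower_mem p ((C.coeff i)⁻¹ * a * b⁻¹) hb)
  convert h1 using 1
  rw [term_eq_smul, term_eq_smul]
  simp only [smul_sub, smul_smul]
  rw [inv_mul_cancel₀ hci, one_smul, mul_assoc _ b⁻¹ b, inv_mul_cancel₀ hb0, mul_one]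
  abel

theorem nucleusTerm_dvd_term (C : Circuit F n k d) (K : Submodule F (LinForms F n)) (i : Fin k) :
    C.nucleusTerm K i ∣ C.term i := by
  classical
  rw [nucleusTerm, term]
  exact Dvd.dvd.mul_left (Finset.prod_dvd_prod_of_subset _ _ _ (Finset.filter_subset _ _)) _

/-- A strongly minimal identity has a nucleus. -/
theorem exists_isNucleus [NeZero k] (C : Circuit F n k d) (hzero : C.IsIdentity)
    (hmin : C.IsStronglyMinimal) {I : Set (Fin k)} (hI : LinearIndepOn F C.term I) :
    ∃ K : Submodule F (LinForms F n), C.IsNucleus I K := by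
  classical
  obtain ⟨K, hK, hsep⟩ := C.exists_separating_space _ le_rfl
  have hterm : ∀ i, C.term i ∈ Submodule.span F (Set.range C.term) :=
    fun i => Submodule.subset_span ⟨i, rfl⟩
  have hmatch : ∀ i, ∃ π : Fin d ≃ Fin d, IsMatching K (C.form 0) (C.form i) π := by
    by_contra! hne
    obtain ⟨l, hl⟩ := hne
    let S : Finset (Fin k) := {i | ∃ π : Fin d ≃ Fin d, IsMatching K (C.form 0) (C.form i) π}
    have h0S : (0 : Fin k) ∈ S := by
      simpa [S] using ⟨_, IsMatching.refl K (C.form 0)⟩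
    have hlS : l ∉ S := by simpa [S] using hl
    have hD0 := C.sum_term_ne_zero hzero hmin h0S hlS
    obtain ⟨p, hp⟩ := hsep _ (Submodule.sum_mem _ fun i _ => hterm i) hD0
    obtain ⟨i, hiS, hi⟩ : ∃ i ∈ S, C.term i ∉ p := by
      by_contra! h
      exact hp.2.1 (Submodule.sum_mem _ h)
    -- The terms outside `S` sum to minus the chosen element, which is not in `p`.
    obtain ⟨j, hjS, hj⟩ : ∃ j ∈ Sᶜ, C.term j ∉ p := by
      by_contra! h
      apply hp.2.1
      have h1 := Finset.sum_add_sum_compl S C.term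
      rw [hzero] at h1
      rw [eq_neg_of_add_eq_zero_left h1]
      exact neg_mem (Submodule.sum_mem _ h)
    obtain ⟨π, hπ⟩ := (Finset.mem_filter.mp hiS).2
    obtain ⟨ρ, hρ⟩ := C.exists_matching_of_separates hp hi hj
    exact (Finset.mem_compl.mp hjS) (by simpa [S] using ⟨_, hπ.trans hρ⟩)
  refine ⟨K, ?_, hmatch, ?_⟩
  -- The span of the terms has dimension at most `k`, so `dim K ≤ k * k < 2 * k ^ 2`.
  · have h1 : Module.finrank F (Submodule.span F (Set.range C.term)) ≤ k := by
      exact (finrank_range_le_card (R := F) C.term).trans_eq (Fintype.card_fin k)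
    have hk : 0 < k := Nat.pos_of_ne_zero (NeZero.ne k)
    nlinarith
  · obtain ⟨q, e, M, δ, hq, hM, hδ, h⟩ := C.exists_splitCoeff_term hmatch
    rw [linearIndepOn_iff']
    intro s α hs hα
    by_contra! hne
    obtain ⟨l, hls, hαl⟩ := hne
    -- The weights `(δ i)⁻¹` undo the scalars in the leading parts, so the leading part of `D` is
    -- the assumed relation times `M`, that is, zero.
    set D := ∑ i ∈ s, (α i * (δ i)⁻¹) • C.term i with hDdef
    have hD0 : D ≠ 0 := by
      intro h0
      have := linearIndepOn_iff'.mp hI s (fun i => α i * (δ i)⁻¹) hs h0 l hls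
      exact mul_ne_zero hαl (inv_ne_zero (hδ l)) this
    have hsplit : splitCoeff q e D = 0 := by
      have : splitCoeff q e D = MvPolynomial.C (∑ i ∈ s, α i • C.nucleusTerm K i) *
          map (algebraMap F (MvPolynomial (Fin n) F)) M := by
        rw [hDdef, map_sum, map_sum, Finset.sum_mul]
        refine Finset.sum_congr rfl fun i _ => ?_
        rw [map_smul, h i]
        ext1 m
        rw [coeff_smul, coeff_C_mul_map, coeff_C_mul_map, smul_smul, smul_smul, smul_smul]
        congr 1
        have := hδ i
        field_simp
      rw [this, hα, map_zero, zero_mul]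
    obtain ⟨p, hp, hDp, hT⟩ := hsep D
      (Submodule.sum_mem _ fun i _ => Submodule.smul_mem _ _ (hterm i)) hD0
    apply hDp
    refine Submodule.sum_mem _ fun i _ => Submodule.smul_of_tower_mem p _ ?_
    obtain ⟨γ, hγ⟩ := hT i
    obtain ⟨m, hm⟩ := ne_zero_iff.mp hM
    -- Since `D` has zero leading part, `T_i - γ D ∈ p` leaves a nonzero multiple of `K_i` in `p`,
    -- and `K_i` divides `T_i`.
    have h1 := hp.coeff_splitCoeff_mem hq hγ e m
    rw [map_sub, map_smul, hsplit, smul_zero, sub_zero, h i, coeff_C_mul_map] at h1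
    exact Ideal.mem_of_dvd _ (C.nucleusTerm_dvd_term K i)
      (mem_of_smul_mem (hδ i) (mem_of_smul_mem hm h1))

end Circuit

end DepthThree

end

noncomputable section

namespace DepthThree

open MvPolynomial

/-! ### Minimal relations between elementary tensors -/

section Tensor

variable {E ι σ Y : Type*} [Field E] [Fintype ι]

/-- The linear relations between the tensor products over `s ∈ Q` of the vectors `x i s`. -/
def relationSpace (x : ι → σ → Y → E) (Q : Finset σ) : Submodule E (ι → E) where
  carrier := {β | ∀ α : σ → Y, ∑ i, β i * ∏ s ∈ Q, x i s (α s) = 0}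
  add_mem' ha hb α := by
    simp only [Pi.add_apply, add_mul, Finset.sum_add_distrib]
    rw [ha α, hb α, add_zero]
  zero_mem' α := by simp
  smul_mem' c b hb α := by
    simp only [Pi.smul_apply, smul_eq_mul, mul_assoc, ← Finset.mul_sum]
    rw [hb α, mul_zero]

theorem mem_relationSpace {x : ι → σ → Y → E} {Q : Finset σ} {β : ι → E} :
    β ∈ relationSpace x Q ↔ ∀ α : σ → Y, ∑ i, β i * ∏ s ∈ Q, x i s (α s) = 0 :=
  Iff.rfl

/-- Choosing the coordinate `star s`, where every vector has entry `1`, forgets the factor `s`. -/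
theorem relationSpace_anti {x : ι → σ → Y → E} {star : σ → Y} (hstar : ∀ i s, x i s (star s) = 1)
    {Q Q' : Finset σ} (hQ : Q ⊆ Q') : relationSpace x Q' ≤ relationSpace x Q := by
  classical
  intro β hβ α
  rw [← hβ fun s => if s ∈ Q then α s else star s]
  refine Finset.sum_congr rfl fun i _ => ?_
  congr 1
  rw [← Finset.prod_subset hQ fun s _ hs => by rw [if_neg hs, hstar]]
  exact Finset.prod_congr rfl fun s hs => by rw [if_pos hs]

theorem sum_eq_zero_of_mem_relationSpace_empty {x : ι → σ → Y → E} [Nonempty (σ → Y)] {β : ι → E}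
    (hβ : β ∈ relationSpace x ∅) : ∑ i, β i = 0 := by
  simpa using hβ (Classical.arbitrary _)

/-- If tensoring with `x · s` imposes no new relations, then the relations can be restricted to the
classes of the indices `i` with equal `x i s`. -/
theorem exists_subsum_eq_zero [DecidableEq σ] {x : ι → σ → Y → E} {star : σ → Y}
    (hstar : ∀ i s, x i s (star s) = 1) {Q : Finset σ} {s : σ} (hs : s ∉ Q)
    (h : relationSpace x Q ≤ relationSpace x (insert s Q)) {i₀ i₁ : ι} (hi : x i₀ s ≠ x i₁ s)
    {u : ι → E} (hu : u ∈ relationSpace x Q) :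
    ∃ S : Finset ι, i₀ ∈ S ∧ i₁ ∉ S ∧ ∑ i ∈ S, u i = 0 := by
  classical
  -- The functions multiplying the relation space into itself are closed under products. By `h` they
  -- contain all `i ↦ x i s y` and their affine combinations, hence the Lagrange-type product `g`
  -- below, the indicator of the class of `i₀`.
  let P : (ι → E) → Prop := fun g => ∀ β ∈ relationSpace x Q, β * g ∈ relationSpace x Q
  have hgen : ∀ y, P fun i => x i s y := by
    intro y β hβ α
    have h1 := h hβ (Function.update α s y)
    rw [← h1]
    refine Finset.sum_congr rfl fun i _ => ?_
    rw [Finset.prod_insert hs, Function.update_self, Pi.mul_apply, mul_assoc]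
    congr 2
    refine Finset.prod_congr rfl fun t ht => ?_
    rw [Function.update_of_ne]
    rintro rfl
    exact hs ht
  have hlin : ∀ y (a b : E), P fun i => (x i s y - a) * b := by
    intro y a b β hβ
    have h1 := (relationSpace x Q).smul_mem b
      (sub_mem (hgen y β hβ) ((relationSpace x Q).smul_mem a hβ))
    convert h1 using 1
    ext i
    simp
    ring
  have hex : ∀ j : ι, ∃ y, x j s ≠ x i₀ s → x j s y ≠ x i₀ s y := by
    intro j
    by_cases hj : x j s = x i₀ s
    · exact ⟨star s, fun h => absurd hj h⟩
    · obtain ⟨y, hy⟩ := Function.ne_iff.mp hj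
      exact ⟨y, fun _ => hy⟩
  choose y hy using hex
  let g : ι → E := ∏ j with x j s ≠ x i₀ s,
    fun i => (x i s (y j) - x j s (y j)) * (x i₀ s (y j) - x j s (y j))⁻¹
  have hg : P g := by
    refine Finset.prod_induction _ P ?_ ?_ ?_
    · intro a b ha hb β hβ
      rw [← mul_assoc]
      exact hb _ (ha β hβ)
    · intro β hβ
      rwa [mul_one]
    · intro j _
      exact hlin _ _ _
  have hg1 : ∀ i, g i = if x i s = x i₀ s then 1 else 0 := by
    intro i
    simp only [g, Finset.prod_apply]
    split_ifs with hi
    · refine Finset.prod_eq_one fun j hj => ?_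
      rw [hi, mul_inv_cancel₀]
      exact sub_ne_zero.mpr (hy j (Finset.mem_filter.mp hj).2).symm
    · exact Finset.prod_eq_zero (Finset.mem_filter.mpr ⟨Finset.mem_univ i, hi⟩) (by simp)
  refine ⟨Finset.univ.filter fun i => x i s = x i₀ s, by simp, by simpa using hi.symm, ?_⟩
  have : Nonempty (σ → Y) := ⟨star⟩
  have h1 := sum_eq_zero_of_mem_relationSpace_empty
    (relationSpace_anti hstar (Finset.empty_subset Q) (hg u hu))
  simpa [hg1, Finset.sum_filter] using h1

/-- In a minimal relation between few more elementary tensors than there are factors, some factor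
is constant. -/
theorem exists_constant_factor [Fintype σ] {x : ι → σ → Y → E} {star : σ → Y}
    (hstar : ∀ i s, x i s (star s) = 1) (hcard : Fintype.card ι ≤ Fintype.card σ + 1)
    {u : ι → E} (hu0 : u ≠ 0)
    (hu : ∀ S : Finset ι, ∀ i j, i ∈ S → j ∉ S → ∑ i ∈ S, u i ≠ 0)
    (hrel : ∀ α : σ → Y, ∑ i, u i * ∏ s, x i s (α s) = 0) :
    ∃ s, ∀ i j, x i s = x j s := by
  classical
  by_contra! hne
  -- The empty product already imposes the condition that the weights sum to zero, whence the `+ 1`.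
  -- Each nonconstant factor then lowers the dimension, as otherwise a proper subsum of `u` would
  -- vanish.
  have hstep : ∀ Q : Finset σ, Module.finrank E (relationSpace x Q) + Q.card + 1 ≤
      Fintype.card ι := by
    intro Q
    induction Q using Finset.induction_on with
    | empty =>
      obtain ⟨i, hi⟩ := Function.ne_iff.mp hu0
      have hlt : relationSpace x ∅ < ⊤ := by
        rw [lt_top_iff_ne_top]
        intro htop
        have h1 : (Pi.single i 1 : ι → E) ∈ relationSpace x ∅ := htop ▸ Submodule.mem_top
        have : Nonempty (σ → Y) := ⟨star⟩
        simpa using sum_eq_zero_of_mem_relationSpace_empty h1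
      have := Submodule.finrank_lt hlt.ne
      rw [Module.finrank_fintype_fun_eq_card] at this
      simpa using this
    | insert s Q hs ih =>
      obtain ⟨i, j, hij⟩ := hne s
      have hlt : relationSpace x (insert s Q) < relationSpace x Q := by
        refine lt_of_le_not_ge (relationSpace_anti hstar (Finset.subset_insert s Q)) fun h => ?_
        obtain ⟨S, hiS, hjS, h0⟩ := exists_subsum_eq_zero hstar hs h hij
          (relationSpace_anti hstar (Finset.subset_univ Q) (mem_relationSpace.mpr hrel))
        exact hu S i j hiS hjS h0
      have := Submodule.finrank_lt_finrank_of_lt hlt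
      rw [Finset.card_insert_of_notMem hs]
      omega
  have h1 := hstep Finset.univ
  rw [Finset.card_univ] at h1
  have h2 : Module.finrank E (relationSpace x Finset.univ) = 0 := by omega
  rw [Submodule.finrank_eq_zero] at h2
  apply hu0
  rw [← Submodule.mem_bot E, ← h2]
  exact hrel

end Tensor

theorem coeff_prod_aeval_X {A σ : Type*} [CommRing A] [Fintype σ] (f : σ → Polynomial A)
    (α : σ → ℕ) :
    (∏ s, Polynomial.aeval (X s : MvPolynomial σ A) (f s)).coeff
      (Finsupp.equivFunOnFinite.symm α) = ∏ s, (f s).coeff (α s) := by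
  classical
  let N := (Finset.univ.sup fun s => (f s).natDegree + α s) + 1
  have hN : ∀ s, (f s).natDegree + α s < N := fun s =>
    Nat.lt_succ_of_le (Finset.le_sup (f := fun s => (f s).natDegree + α s) (Finset.mem_univ s))
  have h1 : ∀ s, Polynomial.aeval (X s : MvPolynomial σ A) (f s) =
      ∑ a ∈ Finset.range N, C ((f s).coeff a) * X s ^ a := by
    intro s
    rw [Polynomial.aeval_def,
      Polynomial.eval₂_eq_sum_range' _ (lt_of_le_of_lt (Nat.le_add_right _ _) (hN s))]
    rfl
  have h2 : ∀ β : σ → ℕ, ∏ s, (C ((f s).coeff (β s)) * X s ^ β s : MvPolynomial σ A) =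
      monomial (Finsupp.equivFunOnFinite.symm β) (∏ s, (f s).coeff (β s)) := by
    intro β
    rw [monomial_eq, Finset.prod_mul_distrib, map_prod, Finsupp.prod_fintype _ _ (by simp)]
    rfl
  simp only [h1]
  rw [Finset.prod_univ_sum, coeff_sum]
  simp only [h2, coeff_monomial, EmbeddingLike.apply_eq_iff_eq]
  rw [Finset.sum_ite_eq', if_pos]
  simp only [Fintype.mem_piFinset, Finset.mem_range]
  intro s
  have := hN s
  omega

/-! ### Transport of Sylvester-Gallai sets and normalization of directions -/

section SylvesterGallai

variable {F M M' : Type*} [Field F] [AddCommGroup M] [Module F M] [AddCommGroup M'] [Module F M']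

theorem IsSGClosed.image {k : ℕ} {S : Set M} (h : IsSGClosed F k S) (e : M ≃ₗ[F] M') :
    IsSGClosed F k (e '' S) where
  ne_zero := by
    rintro _ ⟨v, hv, rfl⟩
    simpa using h.ne_zero v hv
  no_multiples := by
    rintro _ ⟨v, hv, rfl⟩ _ ⟨w, hw, rfl⟩ hne c hc
    rw [← map_smul] at hc
    exact h.no_multiples v hv w hw (fun h => hne (h ▸ rfl)) c (e.injective hc)
  closed := by
    classical
    intro V' hV' hcard hind
    obtain ⟨V, hVS, rfl⟩ := Finset.subset_set_image_iff.mp hV'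
    rw [Finset.card_image_of_injective _ e.injective] at hcard
    rw [Finset.coe_image] at hind ⊢
    have hind' : LinearIndepOn F id (V : Set M) := by
      have h1 := (linearIndepOn_iff_image (f := e) e.injective.injOn).mpr hind
      exact LinearIndependent.of_comp (e : M →ₗ[F] M') h1
    have hspan : (Submodule.span F (e '' (V : Set M)) : Set M') =
        e '' (Submodule.span F (V : Set M) : Set M) := by
      rw [← LinearEquiv.coe_coe, ← Submodule.map_span, Submodule.map_coe]
    rw [hspan, ← Set.image_inter e.injective, e.injective.encard_image]
    exact h.closed V hVS hcard hind'

theorem IsSGClosed.finrank_le_SG [FiniteDimensional F M] {k m : ℕ} (hk : 1 ≤ k) {S : Set M}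
    (h : IsSGClosed F k S) (hS : S.encard ≤ m) : Set.finrank F S ≤ SG k F m := by
  let e : M ≃ₗ[F] (Fin (Module.finrank F M) → F) := (Module.finBasis F M).equivFun
  refine (SG_isGreatest hk F m).2 ⟨_, e '' S, ?_, h.image e, ?_⟩
  · rwa [e.injective.encard_image]
  · rw [Set.finrank, Set.finrank, ← LinearEquiv.coe_coe, ← Submodule.map_span]
    exact LinearEquiv.finrank_map_eq e _

/-- A choice of one representative on each line through the origin. -/
theorem exists_normalization (F M : Type*) [Field F] [AddCommGroup M] [Module F M] :
    ∃ (ρ : M → M) (κ : M → F), (∀ v, κ v ≠ 0) ∧ (∀ v, ρ v = κ v • v) ∧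
      ∀ v (c : F), c ≠ 0 → ρ (c • v) = ρ v := by
  classical
  let ρ : M → M := fun v => if h : v = 0 then 0 else (Projectivization.mk F v h).rep
  have h1 : ∀ v, ∃ c : F, c ≠ 0 ∧ ρ v = c • v := by
    intro v
    by_cases h : v = 0
    · exact ⟨1, one_ne_zero, by simp [ρ, h]⟩
    · obtain ⟨a, ha⟩ := Projectivization.exists_smul_eq_mk_rep F v h
      exact ⟨a, a.ne_zero, by simp [ρ, h, ← ha, Units.smul_def]⟩
  choose κ hκ hρ using h1
  refine ⟨ρ, κ, hκ, hρ, fun v c hc => ?_⟩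
  by_cases h : v = 0
  · simp [h]
  · have h' : c • v ≠ 0 := smul_ne_zero hc h
    simp only [ρ, dif_neg h, dif_neg h']
    congr 1
    rw [Projectivization.mk_eq_mk_iff']
    exact ⟨c, rfl⟩

end SylvesterGallai

end DepthThree

end

noncomputable section

namespace DepthThree

open MvPolynomial

/-! ### Bounding the rank outside a nucleus -/

variable {F : Type*} [Field F] {n k d : ℕ}

/-- Independence handles a set avoiding `l`. A set containing `l` is replaced by its complement,
whose sum would vanish as well. -/
theorem subsum_ne_zero {ι M : Type*} [Fintype ι] [AddCommGroup M] [Module F M] {N : ι → M} {l : ι}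
    (hN : LinearIndepOn F N {i | i ≠ l}) {w : ι → F} (hw : ∀ i, w i ≠ 0)
    (h : ∑ i, w i • N i = 0) (S : Finset ι) (i j : ι) (hi : i ∈ S) (hj : j ∉ S) :
    ∑ i ∈ S, w i • N i ≠ 0 := by
  classical
  have key : ∀ S : Finset ι, S.Nonempty → l ∉ S → ∑ i ∈ S, w i • N i ≠ 0 := by
    rintro S ⟨i, hi⟩ hl h0
    refine hw i (linearIndepOn_iff'.mp hN S w (fun a ha => ?_) h0 i hi)
    rintro rfl
    exact hl ha
  intro h0
  by_cases hl : l ∈ S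
  · refine key Sᶜ ⟨j, by simpa using hj⟩ (by simpa using hl) ?_
    have := Finset.sum_add_sum_compl S fun i => w i • N i
    rwa [h, h0, zero_add] at this
  · exact key S ⟨i, hi⟩ hl h0

namespace Circuit

theorem term_ne_zero (C : Circuit F n k d) (i : Fin k) : C.term i ≠ 0 := by
  rw [term_eq_smul]
  exact smul_ne_zero (C.coeff_ne_zero i) (prod_form_ne_zero fun j _ => C.form_ne_zero i j)

theorem two_le_of_isIdentity [NeZero k] (C : Circuit F n k d) (hzero : C.IsIdentity) : 2 ≤ k := by
  by_contra hk
  have : k = 1 := by have := NeZero.ne k; omega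
  subst this
  rw [IsIdentity, Fin.sum_univ_one] at hzero
  exact C.term_ne_zero 0 hzero

/-- A maximal independent set of terms omits exactly one term. -/
theorem exists_eq_ne [NeZero k] (C : Circuit F n k d) (hzero : C.IsIdentity)
    (hmin : C.IsStronglyMinimal) {I : Set (Fin k)}
    (hI : Maximal (fun J : Set (Fin k) => LinearIndepOn F C.term J) I) :
    ∃ l, I = {i | i ≠ l} := by
  classical
  obtain ⟨l, hl⟩ : ∃ l, l ∉ I := by
    by_contra! h
    have h1 := linearIndepOn_iff'.mp hI.1 Finset.univ (fun _ => 1) (fun i _ => h i)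
      (by simp only [one_smul]; exact hzero) 0 (Finset.mem_univ _)
    exact one_ne_zero h1
  refine ⟨l, (hI.eq_of_subset ?_ ?_)⟩
  · rw [linearIndepOn_iff']
    intro s g hs hg i hi
    have hls : l ∉ s := fun h => hs h rfl
    have := C.relation_eq hzero hmin (α := fun i => if i ∈ s then g i else 0)
      (by simpa [ite_smul] using hg) i l
    simpa [hi, hls] using this
  · rintro i hi rfl
    exact hl hi

/-- If the forms outside `K` with directions in the span of `k - 1` independent directions have one
of these directions, then some form divides all terms. -/
theorem exists_common_form [NeZero k] (C : Circuit F n k d) (hzero : C.IsIdentity)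
    {l : Fin k} {K : Submodule F (LinForms F n)} (hK : C.IsNucleus {i | i ≠ l} K)
    {ρ : (LinForms F n ⧸ K) → LinForms F n ⧸ K} {κ : (LinForms F n ⧸ K) → F}
    (hκ : ∀ v, κ v ≠ 0) (hρ : ∀ v, ρ v = κ v • v) (hρs : ∀ v (c : F), c ≠ 0 → ρ (c • v) = ρ v)
    (V : Finset (LinForms F n ⧸ K)) (hV0 : ∀ v ∈ V, v ≠ 0) (hVk : k ≤ V.card + 1)
    (hVS : ∀ v ∈ V, ∃ j, ρ (K.mkQ (C.form 0 j)) = v)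
    (hind : LinearIndepOn F id (V : Set (LinForms F n ⧸ K)))
    (hV : ∀ i j, C.form i j ∉ K → K.mkQ (C.form i j) ∈ Submodule.span F (V : Set _) →
      ρ (K.mkQ (C.form i j)) ∈ V) :
    ∃ g : LinForms F n, g ≠ 0 ∧ ∀ i, (g : MvPolynomial (Fin n) F) ∣ C.term i := by
  classical
  obtain ⟨lift, hlift⟩ : ∃ lift : (LinForms F n ⧸ K) → LinForms F n, ∀ v, K.mkQ (lift v) = v :=
    ⟨Function.surjInv K.mkQ_surjective, Function.surjInv_eq _⟩
  obtain ⟨G, hG⟩ : ∃ G : (LinForms F n ⧸ K) →ₗ[F] (V →₀ F),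
      ∀ v : V, G v = Finsupp.single v 1 := by
    have hli : LinearIndependent F (fun v : V => (v : LinForms F n ⧸ K)) := hind
    obtain ⟨G, hG⟩ := LinearMap.exists_extend hli.repr
    refine ⟨G, fun v => ?_⟩
    have hv : (v : LinForms F n ⧸ K) ∈ Submodule.span F
        (Set.range fun v : V => (v : LinForms F n ⧸ K)) := Submodule.subset_span ⟨v, rfl⟩
    have h1 := DFunLike.congr_fun hG ⟨v, hv⟩
    rw [LinearMap.comp_apply, Submodule.subtype_apply] at h1
    rw [h1]
    exact hli.repr_eq_single v _ rfl
  set Dir : Fin k → Fin d → LinForms F n ⧸ K := fun i j => ρ (K.mkQ (C.form i j)) with hDir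
  set a : Fin k → Fin d → LinForms F n := fun i j =>
    κ (K.mkQ (C.form i j)) • C.form i j - lift (Dir i j) with ha
  have hDir0 : ∀ i j, Dir i j = 0 ↔ C.form i j ∈ K := by
    intro i j
    simp only [hDir, hρ, smul_eq_zero, hκ, false_or, Submodule.mkQ_apply,
      Submodule.Quotient.mk_eq_zero]
  choose π hπ using hK.matched
  have hDirπ : ∀ i j, Dir i (π i j) = Dir 0 j := by
    intro i j
    obtain ⟨c, hc, v, hv, e⟩ := hπ i j
    simp only [hDir]
    rw [e, map_add, map_smul, Submodule.mkQ_apply K v, (Submodule.Quotient.mk_eq_zero K).mpr hv,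
      add_zero, hρs _ _ hc]
  let P : LinForms F n →ₗ[F] LinForms F n := LinearMap.id -
    ∑ v : V, ((Finsupp.lapply v ∘ₗ G ∘ₗ K.mkQ : LinForms F n →ₗ[F] F)).smulRight (lift v)
  have hP : ∀ x, P x = x - ∑ v : V, G (K.mkQ x) v • lift v := by
    intro x
    simp [P]
  -- `Ψ` fixes `K` and replaces the representative `lift v` of each direction by the variable `X v`.
  -- A form of direction `v`, normalized by `κ`, becomes `X v + a i j`.
  let Ψ : LinForms F n →ₗ[F] MvPolynomial V (MvPolynomial (Fin n) F) :=
    (IsScalarTower.toAlgHom F (MvPolynomial (Fin n) F) _).toLinearMap ∘ₗ Submodule.subtype _ ∘ₗ P +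
    ∑ v : V, ((Finsupp.lapply v ∘ₗ G ∘ₗ K.mkQ : LinForms F n →ₗ[F] F)).smulRight (X v)
  have hΨ : ∀ x, Ψ x = MvPolynomial.C (P x : MvPolynomial (Fin n) F) +
      ∑ v : V, G (K.mkQ x) v • X v := by
    intro x
    simp [Ψ, MvPolynomial.algebraMap_eq]
  have hΨK : ∀ x ∈ K, Ψ x = MvPolynomial.C (x : MvPolynomial (Fin n) F) := by
    intro x hx
    have : K.mkQ x = 0 := (Submodule.Quotient.mk_eq_zero K).mpr hx
    rw [hΨ, hP, this]
    simp
  have hΨV : ∀ i j (v : V), Dir i j = v → Ψ (C.form i j) =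
      (κ (K.mkQ (C.form i j)))⁻¹ • Polynomial.aeval (X v : MvPolynomial V (MvPolynomial (Fin n) F))
        (Polynomial.X + Polynomial.C (a i j : MvPolynomial (Fin n) F)) := by
    intro i j v hv
    have hκ0 := hκ (K.mkQ (C.form i j))
    have h1 : K.mkQ (C.form i j) = (κ (K.mkQ (C.form i j)))⁻¹ • (v : LinForms F n ⧸ K) := by
      rw [← hv, hDir]
      simp only
      rw [hρ, smul_smul, inv_mul_cancel₀ hκ0, one_smul]
    have h2 : G (K.mkQ (C.form i j)) = Finsupp.single v (κ (K.mkQ (C.form i j)))⁻¹ := by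
      rw [h1, map_smul, hG, ← h1]
      simp
    have h3 : ((P (C.form i j) : LinForms F n)) = (κ (K.mkQ (C.form i j)))⁻¹ • a i j := by
      rw [hP, h2, Finset.sum_eq_single v (by
        intro w _ hw
        rw [Finsupp.single_eq_of_ne hw, zero_smul]) (by simp)]
      rw [Finsupp.single_eq_same, ha]
      simp only
      rw [hv, smul_sub, smul_smul, inv_mul_cancel₀ hκ0, one_smul]
    rw [hΨ, h2, h3, Finset.sum_eq_single v (by
        intro w _ hw
        rw [Finsupp.single_eq_of_ne hw, zero_smul]) (by simp)]
    rw [Finsupp.single_eq_same, Submodule.coe_smul, map_add, Polynomial.aeval_X, Polynomial.aeval_C,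
      smul_add, MvPolynomial.algebraMap_eq, add_comm]
    congr 1
    ext m
    simp [MvPolynomial.coeff_C, coeff_smul]
  set f : Fin k → V → Polynomial (MvPolynomial (Fin n) F) := fun i v =>
    ∏ j with Dir i j = v, (Polynomial.X + Polynomial.C (a i j : MvPolynomial (Fin n) F)) with hf
  set θ : Fin k → F := fun i =>
    ∏ v : V, ∏ j with Dir i j = v, (κ (K.mkQ (C.form i j)))⁻¹ with hθ
  have hθ0 : ∀ i, θ i ≠ 0 := fun i => Finset.prod_ne_zero_iff.mpr fun v _ =>
    Finset.prod_ne_zero_iff.mpr fun j _ => inv_ne_zero (hκ _)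
  -- The part of a term in `K₁` is its part in `K` times its forms with direction in `V`: by `hV` no
  -- other direction occurs in the span.
  let K₁ : Submodule F (LinForms F n) := (Submodule.span F (V : Set (LinForms F n ⧸ K))).comap K.mkQ
  have hKK₁ : K ≤ K₁ := by
    intro x hx
    rw [Submodule.mem_comap, Submodule.mkQ_apply, (Submodule.Quotient.mk_eq_zero K).mpr hx]
    exact zero_mem _
  have hDirK₁ : ∀ i j, Dir i j ∈ V → C.form i j ∈ K₁ := by
    intro i j h
    have h1 : Dir i j ∈ Submodule.span F (V : Set (LinForms F n ⧸ K)) := Submodule.subset_span h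
    simp only [hDir, hρ] at h1
    exact (Submodule.smul_mem_iff _ (hκ _)).mp h1
  have hΨN : ∀ i, liftLin Ψ (C.nucleusTerm K₁ i) =
      θ i • (MvPolynomial.C (C.nucleusTerm K i) * ∏ v : V, Polynomial.aeval (X v) (f i v)) := by
    intro i
    rw [nucleusTerm, map_prod, Finset.prod_congr rfl fun j _ => liftLin_coe Ψ (C.form i j),
      ← Finset.prod_filter_mul_prod_filter_not _ (fun j => C.form i j ∈ K), Finset.filter_filter]
    have h1 : ∏ j with C.form i j ∈ K₁ ∧ C.form i j ∈ K, Ψ (C.form i j) =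
        MvPolynomial.C (C.nucleusTerm K i) := by
      rw [nucleusTerm, map_prod]
      refine Finset.prod_congr ?_ fun j hj => hΨK _ (Finset.mem_filter.mp hj).2
      ext j
      simpa using fun h => hKK₁ h
    have h2 : ∏ j ∈ {j | C.form i j ∈ K₁} with C.form i j ∉ K, Ψ (C.form i j) =
        θ i • ∏ v : V, Polynomial.aeval (X v) (f i v) := by
      rw [← Finset.prod_fiberwise_of_maps_to (t := V) (g := Dir i), ← Finset.prod_coe_sort, hθ,
        ← Finset.prod_smul]
      · refine Finset.prod_congr rfl fun v _ => ?_
        rw [hf, map_prod, ← Finset.prod_smul]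
        refine Finset.prod_congr ?_ fun j hj => hΨV i j v (Finset.mem_filter.mp hj).2
        ext j
        simp only [Finset.mem_filter, Finset.mem_univ, true_and, and_iff_right_iff_imp]
        intro hj
        refine ⟨hDirK₁ i j (hj ▸ v.2), fun h0 => hV0 v v.2 ?_⟩
        rw [← hj, hDir0]
        exact h0
      · intro j hj
        simp only [Finset.mem_filter, Finset.mem_univ, true_and] at hj
        exact hV i j hj.2 hj.1
    rw [h1, h2, mul_smul_comm]
  obtain ⟨δ, hδ, hsum⟩ := C.sum_smul_nucleusTerm_eq_zero hzero
    (fun i => ⟨π i, (hπ i).mono hKK₁⟩)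
  have hrel : ∀ α : V → ℕ,
      ∑ i, ((δ i * θ i) • C.nucleusTerm K i) * ∏ v, (f i v).coeff (α v) = 0 := by
    intro α
    have h1 := congrArg (MvPolynomial.coeff (Finsupp.equivFunOnFinite.symm α) ∘ liftLin Ψ) hsum
    simp only [Function.comp_apply, map_sum, map_smul, hΨN, coeff_sum, map_zero, coeff_zero,
      coeff_smul, coeff_C_mul, coeff_prod_aeval_X] at h1
    rw [← h1]
    refine Finset.sum_congr rfl fun i _ => ?_
    rw [smul_mul_assoc, mul_smul]
  have hmonic : ∀ i (v : V), (f i v).Monic := fun i v =>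
    Polynomial.monic_prod_of_monic _ _ fun j _ => Polynomial.monic_X_add_C _
  have hdeg : ∀ i (v : V), (f i v).natDegree = (Finset.univ.filter fun j => Dir 0 j = v).card := by
    intro i v
    rw [hf, Polynomial.natDegree_prod_of_monic _ _ fun j _ => Polynomial.monic_X_add_C _]
    simp only [Polynomial.natDegree_X_add_C, Finset.sum_const, smul_eq_mul, mul_one]
    symm
    refine Finset.card_bij (fun j _ => π i j) ?_ (fun _ _ _ _ e => (π i).injective e) ?_
    · intro j hj
      simpa [hDirπ] using hj
    · intro j hj
      refine ⟨(π i).symm j, ?_, by simp⟩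
      simpa [← hDirπ i] using hj
  -- Matching makes the degree of `f i v` independent of `i`, so the leading coefficient serves as
  -- the coordinate normalized to `1` for the tensor lemma.
  have hlead : ∀ i (v : V),
      (f i v).coeff (Finset.univ.filter fun j => Dir 0 j = v).card = 1 := by
    intro i v
    rw [← hdeg i v]
    exact hmonic i v
  have hsum0 : ∑ i, (δ i * θ i) • C.nucleusTerm K i = 0 := by
    have := hrel fun v => (Finset.univ.filter fun j => Dir 0 j = v).card
    simpa [hlead] using this
  have hδθ : ∀ i, δ i * θ i ≠ 0 := fun i => mul_ne_zero (hδ i) (hθ0 i)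
  have hN0 : C.nucleusTerm K 0 ≠ 0 := prod_form_ne_zero fun j _ => C.form_ne_zero 0 j
  let E := FractionRing (MvPolynomial (Fin n) F)
  have hinj : Function.Injective (algebraMap (MvPolynomial (Fin n) F) E) :=
    IsFractionRing.injective _ _
  obtain ⟨v, hv⟩ := exists_constant_factor (E := E)
    (x := fun i (v : V) m => algebraMap (MvPolynomial (Fin n) F) E ((f i v).coeff m))
    (star := fun v => (Finset.univ.filter fun j => Dir 0 j = v).card)
    (fun i v => by rw [hlead, map_one]) (by simpa using hVk)
    (u := fun i => algebraMap _ E ((δ i * θ i) • C.nucleusTerm K i))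
    (by
      intro h0
      have h1 := congrFun h0 0
      rw [Pi.zero_apply, ← map_zero (algebraMap (MvPolynomial (Fin n) F) E)] at h1
      exact smul_ne_zero (hδθ 0) hN0 (hinj h1))
    (by
      intro S i j hi hj h0
      rw [← map_sum, ← map_zero (algebraMap (MvPolynomial (Fin n) F) E)] at h0
      exact subsum_ne_zero hK.indep hδθ hsum0 S i j hi hj (hinj h0))
    (by
      intro α
      have h1 := congrArg (algebraMap _ E) (hrel α)
      simpa only [map_sum, map_mul, map_prod, map_zero] using h1)
  have hfeq : ∀ i, f i v = f 0 v := by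
    intro i
    ext1 m
    exact hinj (congrFun (hv i 0) m)
  obtain ⟨j₀, hj₀⟩ := hVS v v.2
  refine ⟨a 0 j₀ + lift v, ?_, fun i => ?_⟩
  · intro h0
    apply hV0 v v.2
    have h1 := congrArg K.mkQ h0
    have h2 : a 0 j₀ + lift v = κ (K.mkQ (C.form 0 j₀)) • C.form 0 j₀ := by
      simp only [ha, hDir, hj₀, sub_add_cancel]
    rw [h2, map_smul, ← hρ, hj₀, map_zero] at h1
    exact h1
  -- The form `j₀` of the first term gives a root of `f 0 v = f i v`, so term `i` has a form with
  -- the same offset and direction, hence proportional to the form `j₀`.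
  · have hroot : (f i v).eval (-(a 0 j₀ : MvPolynomial (Fin n) F)) = 0 := by
      rw [hfeq, hf, Polynomial.eval_prod]
      exact Finset.prod_eq_zero (Finset.mem_filter.mpr ⟨Finset.mem_univ j₀, hj₀⟩) (by simp)
    rw [hf, Polynomial.eval_prod, Finset.prod_eq_zero_iff] at hroot
    obtain ⟨j, hj, hroot⟩ := hroot
    have haj : a i j = a 0 j₀ := by
      apply Subtype.ext
      rw [Polynomial.eval_add, Polynomial.eval_X, Polynomial.eval_C] at hroot
      rw [← sub_eq_zero, ← hroot]
      ring
    have hg : a 0 j₀ + lift v = κ (K.mkQ (C.form i j)) • C.form i j := by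
      rw [← haj, ← (Finset.mem_filter.mp hj).2]
      simp only [ha, sub_add_cancel]
    rw [hg, term]
    refine Dvd.dvd.mul_left (dvd_trans ?_ (Finset.dvd_prod_of_mem _ (Finset.mem_univ j))) _
    refine ⟨MvPolynomial.C (κ (K.mkQ (C.form i j)))⁻¹, ?_⟩
    rw [Submodule.coe_smul, MvPolynomial.smul_eq_C_mul, mul_right_comm, ← map_mul,
      mul_inv_cancel₀ (hκ _), map_one, one_mul]

/-- The rank of a simple strongly minimal identity outside a nucleus is a Sylvester-Gallai rank. -/
theorem nonNucleusRank_le_SG [NeZero k] (C : Circuit F n k d) (hzero : C.IsIdentity)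
    (hsimple : C.IsSimple) {l : Fin k} {K : Submodule F (LinForms F n)}
    (hK : C.IsNucleus {i | i ≠ l} K) : C.nonNucleusRank K ≤ SG (k - 1) F d := by
  classical
  have hk := C.two_le_of_isIdentity hzero
  obtain ⟨ρ, κ, hκ, hρ, hρs⟩ := exists_normalization F (LinForms F n ⧸ K)
  have hρ0 : ∀ v, ρ v = 0 ↔ v = 0 := fun v => by simp [hρ, hκ]
  have hρρ : ∀ v, ρ (ρ v) = ρ v := fun v => by
    conv_lhs => rw [hρ v]
    exact hρs _ _ (hκ v)
  have hmk0 : ∀ x, K.mkQ x = 0 ↔ x ∈ K := fun x => Submodule.Quotient.mk_eq_zero K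
  let S : Set (LinForms F n ⧸ K) := {v | v ≠ 0 ∧ ∃ j, ρ (K.mkQ (C.form 0 j)) = v}
  have hmem : ∀ i j, C.form i j ∉ K → ρ (K.mkQ (C.form i j)) ∈ S := by
    intro i j hij
    refine ⟨fun h => hij ((hmk0 _).mp ((hρ0 _).mp h)), ?_⟩
    obtain ⟨π, hπ⟩ := hK.matched i
    obtain ⟨c, hc, v, hv, e⟩ := hπ (π.symm j)
    rw [Equiv.apply_symm_apply] at e
    refine ⟨π.symm j, ?_⟩
    rw [e, map_add, map_smul, (hmk0 v).mpr hv, add_zero, hρs _ _ hc]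
  have hcard : S.encard ≤ d := by
    have h1 : S ⊆ Set.range fun j => ρ (K.mkQ (C.form 0 j)) := fun v hv => hv.2
    refine (Set.encard_le_encard h1).trans ?_
    rw [← Set.image_univ]
    refine (Set.encard_image_le _ _).trans ?_
    simp
  have hSfin : S.Finite := Set.finite_of_encard_le_coe hcard
  have hclosed : IsSGClosed F (k - 1) S := by
    refine ⟨fun v hv => hv.1, ?_, ?_⟩
    · rintro v ⟨hv0, i, rfl⟩ w ⟨hw0, j, rfl⟩ hne c hc
      have hc0 : c ≠ 0 := by
        rintro rfl
        rw [zero_smul] at hc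
        exact hw0 hc
      apply hne
      rw [← hρρ, ← hρs _ c hc0, ← hc, hρρ]
    · intro V hVS hVk hind
      by_contra! hlt
      have hsub : (V : Set _) ⊆ S ∩ (Submodule.span F (V : Set (LinForms F n ⧸ K)) : Set _) :=
        Set.subset_inter hVS Submodule.subset_span
      -- If closure fails, `V` is everything `S` has in its span, which is the hypothesis that
      -- produces a common form.
      have heq : (V : Set _) = S ∩ (Submodule.span F (V : Set (LinForms F n ⧸ K)) : Set _) := by
        refine V.finite_toSet.eq_of_subset_of_encard_le hsub ?_
        rw [Set.encard_coe_eq_coe_finsetCard, hVk]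
        exact Order.le_of_lt_add_one (by exact_mod_cast hlt)
      refine hsimple (C.exists_common_form hzero hK hκ hρ hρs V (fun v hv => (hVS hv).1)
        (by omega) (fun v hv => (hVS hv).2) hind fun i j hij hspan => ?_)
      have h1 : ρ (K.mkQ (C.form i j)) ∈
          S ∩ (Submodule.span F (V : Set (LinForms F n ⧸ K)) : Set _) := by
        refine ⟨hmem i j hij, ?_⟩
        rw [hρ]
        exact Submodule.smul_mem _ _ hspan
      rw [← heq] at h1
      exact h1
  refine le_trans ?_ (hclosed.finrank_le_SG (by omega) hcard)
  refine Submodule.finrank_mono (Submodule.span_le.mpr ?_)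
  rintro _ ⟨x, ⟨⟨i, j, rfl⟩, hx⟩, rfl⟩
  have h1 := Submodule.subset_span (R := F) (hmem i j hx)
  rw [hρ] at h1
  exact (Submodule.smul_mem_iff _ (hκ _)).mp h1

end Circuit

end DepthThree

end

theorem mainTheorem7 {F : Type*} [Field F] {n k d : ℕ} [NeZero k]
    (hF : (d : ℕ∞) < ENat.card F)
    (C : DepthThree.Circuit F n k d) (hzero : C.IsIdentity) (hsimple : C.IsSimple)
    (hmin : C.IsStronglyMinimal)
    (I : Set (Fin k)) (hI : Maximal (fun J : Set (Fin k) => LinearIndepOn F C.term J) I) :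
    (∃ K : Submodule F (DepthThree.LinForms F n), C.IsNucleus I K) ∧
      ∀ K : Submodule F (DepthThree.LinForms F n), C.IsNucleus I K →
        C.nonNucleusRank K ≤ DepthThree.SG (k - 1) F d := by
  refine ⟨C.exists_isNucleus hzero hmin hI.1, fun K hK => ?_⟩
  obtain ⟨l, rfl⟩ := C.exists_eq_ne hzero hmin hI
  exact C.nonNucleusRank_le_SG hzero hsimple hK
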